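/- Let $k$ be a field, let $0\le r\le n$, and let $R=k[x_0,\dots,x_n]$ with the standard grading. Let $P_0,\dots,P_r\in\mathbb P^n(k)$ be $r+1\le n+1$ points in general position, i.e. linearly independent points (equivalently, after a linear change of coordinates, $P_i$ is the $i$-th coordinate point). Let $\mathfrak p_i\subset R$ be the homogeneous ideal of $P_i$, and let $I=\mathfrak p_0^2\cap\cdots\cap\mathfrak p_r^2$ be the ideal of the corresponding double points. Let $\beta_{i,j}(R/I)$ denote the graded Betti numbers of $R/I$, i.e. the number of basis elements of degree $j$ in the $i$-th free module of a minimal graded free resolution of $R/I$ over $R$ (such a resolution exists, and the number does not depend on its choice). Then for all $q\ge 1$, \[ \beta_{q,q+1}(R/I)=\binom{n-r+1}{q+1}\binom{q}{q-1},\] \[ \beta_{q,q+2}(R/I)=(n-r)\sum_{i=0}^{r-1}(r-i)\binom{n-i-1}{q-1}+\sum_{i=0}^{r-2}\binom{r-i}{2}\binom{n-i-2}{q-1},\] \[ \beta_{q,q+3}(R/I)=\binom{r+1}{2}\binom{n-1}{q-1},\] $\beta_{0,0}(R/I)=1$, and all other graded Betti numbers of $R/I$ are zero. (Empty sums are zero.)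 -/

import Mathlib

open scoped LinearAlgebra.Projectivization

/-- The homogeneous vanishing ideal, in `k[x₀, …, xₙ]`, of a point `P` of `ℙⁿ` over `k`: the ideal
generated by the homogeneous polynomials vanishing at `P`. (For homogeneous `f`, whether `f`
vanishes does not depend on the representative of `P`.) -/
noncomputable def pointIdeal {k : Type*} [Field k] {n : ℕ} (P : ℙ k (Fin (n + 1) → k)) :
    Ideal (MvPolynomial (Fin (n + 1)) k) :=
  Ideal.span {f | (∃ d : ℕ, f.IsHomogeneous d) ∧ MvPolynomial.eval P.rep f = 0}

/-- The ideal `𝔭₀ ^ a₀ ∩ ⋯ ∩ 𝔭ᵣ ^ aᵣ` of the fat points `(P₀, a₀), …, (Pᵣ, aᵣ)` of `ℙⁿ`. -/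
noncomputable def fatPointsIdeal {k : Type*} [Field k] {n r : ℕ}
    (P : Fin (r + 1) → ℙ k (Fin (n + 1) → k)) (a : Fin (r + 1) → ℕ) :
    Ideal (MvPolynomial (Fin (n + 1)) k) :=
  ⨅ i, pointIdeal (P i) ^ a i

/-- The degree `j` part of the graded free module `⨁ₐ R(-deg a)`, where `R = k[x_s : s ∈ σ]`:
the vectors whose coordinate at `a` is homogeneous of degree `j - deg a`, and `0` if that number
is negative. -/
def IsHomogeneousVector {k σ : Type*} [Field k] {m : ℕ} (deg : Fin m → ℕ) (j : ℕ)
    (v : Fin m → MvPolynomial σ k) : Prop :=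
  ∀ a, (deg a ≤ j → (v a).IsHomogeneous (j - deg a)) ∧ (j < deg a → v a = 0)

/-- A minimal graded free resolution
`⋯ → F₂ → F₁ → F₀ → R ⧸ I → 0` of `R ⧸ I` over `R = k[x_s : s ∈ σ]`, for a homogeneous ideal `I`.
Here `Fᵢ = ⨁ₐ R(-deg i a)`, with `a` running over `Fin (rank i)`; the maps are homogeneous of
degree `0`, the sequence is exact, and the image of `Fᵢ₊₁` in `Fᵢ` lies in `𝔪 Fᵢ`, where `𝔪` is
the ideal generated by the variables. -/
structure MinimalGradedFreeResolution {k σ : Type*} [Field k] (I : Ideal (MvPolynomial σ k)) where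
  /-- The rank of the `i`-th free module. -/
  rank : ℕ → ℕ
  /-- The degrees of the basis elements of the `i`-th free module. -/
  deg : ∀ i, Fin (rank i) → ℕ
  /-- The differential `Fᵢ₊₁ → Fᵢ`. -/
  d : ∀ i, (Fin (rank (i + 1)) → MvPolynomial σ k) →ₗ[MvPolynomial σ k]
    (Fin (rank i) → MvPolynomial σ k)
  /-- The augmentation `F₀ → R ⧸ I`. -/
  ε : (Fin (rank 0) → MvPolynomial σ k) →ₗ[MvPolynomial σ k] (MvPolynomial σ k ⧸ I)
  d_homogeneous : ∀ (i j : ℕ) (v : Fin (rank (i + 1)) → MvPolynomial σ k),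
    IsHomogeneousVector (deg (i + 1)) j v → IsHomogeneousVector (deg i) j (d i v)
  ε_homogeneous : ∀ (j : ℕ) (v : Fin (rank 0) → MvPolynomial σ k),
    IsHomogeneousVector (deg 0) j v →
      ∃ f : MvPolynomial σ k, f.IsHomogeneous j ∧ Ideal.Quotient.mk I f = ε v
  ε_surjective : Function.Surjective ε
  exact_zero : Function.Exact (d 0) ε
  exact_succ : ∀ i, Function.Exact (d (i + 1)) (d i)
  minimal : ∀ i, LinearMap.range (d i) ≤
    Ideal.span (Set.range (MvPolynomial.X : σ → MvPolynomial σ k)) •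
      (⊤ : Submodule (MvPolynomial σ k) (Fin (rank i) → MvPolynomial σ k))

/-- The graded Betti number `β_{i,j}` read off from a minimal graded free resolution: the number of
basis elements of degree `j` of the `i`-th free module. -/
def MinimalGradedFreeResolution.betti {k σ : Type*} [Field k] {I : Ideal (MvPolynomial σ k)}
    (F : MinimalGradedFreeResolution I) (i j : ℕ) : ℕ :=
  (Finset.univ.filter fun a => F.deg i a = j).card

/-! A linear change of coordinates makes the points coordinate points, and I becomes a monomial
ideal: x^w lies in it iff, for every i ≤ r, its degree in the variables other than x_i is at least
2. Its generators are x_i x_j (i, j > r), x_a x_b x_l (l > r), x_a x_b x_c and x_a² x_b², where a,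
b, c ≤ r are distinct (`doublePointExponents_eq`). Adjoined in this order, lexicographically within
each family, they have linear quotients: the colon of the ideal of the earlier generators by the
next one is generated by variables (the `_colon` lemmas).

If F resolves R/I', G resolves R/(I' : f) and deg f = d, the mapping cone of a lift G(-d) → F of
multiplication by f resolves R/(I' + (f)). When I' : f is generated by s variables, G has the Koszul
Betti numbers, so f adds C(s, q-1) to β_{q,q+d-1}. The cone is minimal for degree reasons: G(-d) in
homological position i lives in degree i + d, and F there only in degrees below i + d, because
generators are added in nondecreasing degree. Each strand is thus a sum of binomials over the
generators of degree 2, 3 or 4; the two sums in the middle strand come from the two cubic families.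

Any other minimal resolution has the same Betti numbers: lifts of the identity in both directions
compose to a map homotopic to the identity, and by minimality the homotopy terms vanish modulo the
variables (`betti_le`). -/

open MvPolynomial

/-! ### Graded free modules and homogeneous maps between them. -/

section HomogeneousVector

variable {k σ : Type*} [Field k]

namespace IsHomogeneousVector

variable {m : ℕ} {deg : Fin m → ℕ} {j t : ℕ} {v w : Fin m → MvPolynomial σ k}

theorem add (hv : IsHomogeneousVector deg j v) (hw : IsHomogeneousVector deg j w) :
    IsHomogeneousVector deg j (v + w) := fun a =>
  ⟨fun h => ((hv a).1 h).add ((hw a).1 h), fun h => by simp [(hv a).2 h, (hw a).2 h]⟩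

theorem zero (deg : Fin m → ℕ) (j : ℕ) :
    IsHomogeneousVector deg j (0 : Fin m → MvPolynomial σ k) := fun _ =>
  ⟨fun _ => isHomogeneous_zero _ _ _, fun _ => rfl⟩

theorem neg (hv : IsHomogeneousVector deg j v) : IsHomogeneousVector deg j (-v) := fun a =>
  ⟨fun h => ((hv a).1 h).neg, fun h => by simp [(hv a).2 h]⟩

theorem smul {f : MvPolynomial σ k} (hf : f.IsHomogeneous t) (hv : IsHomogeneousVector deg j v) :
    IsHomogeneousVector deg (t + j) (f • v) := fun a => by
  by_cases h : deg a ≤ j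
  · refine ⟨fun _ => ?_, fun h' => by omega⟩
    have := hf.mul ((hv a).1 h)
    rwa [← Nat.add_sub_assoc h] at this
  · have h0 : v a = 0 := (hv a).2 (by omega)
    exact ⟨fun _ => by simpa [h0] using isHomogeneous_zero _ _ _, fun _ => by simp [h0]⟩

theorem sum {ι : Type*} (s : Finset ι) (u : ι → Fin m → MvPolynomial σ k)
    (hu : ∀ i ∈ s, IsHomogeneousVector deg j (u i)) : IsHomogeneousVector deg j (∑ i ∈ s, u i) := by
  classical
  induction s using Finset.induction_on with
  | empty => simpa using zero deg j
  | insert a s ha ih =>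
    rw [Finset.sum_insert ha]
    exact (hu a (by simp)).add (ih fun i hi => hu i (by simp [hi]))

theorem single {f : MvPolynomial σ k} (hf : f.IsHomogeneous t) (deg : Fin m → ℕ) (a : Fin m) :
    IsHomogeneousVector deg (deg a + t) (Pi.single a f) := fun b => by
  by_cases h : b = a
  · subst h
    simpa using hf
  · exact ⟨fun _ => by simpa [h] using isHomogeneous_zero σ k _, fun _ => by simp [h]⟩

theorem single_one (deg : Fin m → ℕ) (a : Fin m) :
    IsHomogeneousVector deg (deg a) (Pi.single a (1 : MvPolynomial σ k)) := by
  simpa using single (isHomogeneous_one σ k) deg a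

/-- A vector is a sum of homogeneous vectors. -/
theorem induction (deg : Fin m → ℕ) {p : (Fin m → MvPolynomial σ k) → Prop}
    (hom : ∀ j v, IsHomogeneousVector deg j v → p v) (add : ∀ v w, p v → p w → p (v + w))
    (v : Fin m → MvPolynomial σ k) : p v := by
  have single (a : Fin m) (f : MvPolynomial σ k) : p (Pi.single a f) := by
    induction f using MvPolynomial.induction_on' with
    | monomial u c => exact hom _ _ (single (isHomogeneous_monomial c rfl) deg a)
    | add f g hf hg => rw [Pi.single_add]; exact add _ _ hf hg
  rw [← Finset.univ_sum_single v]
  generalize (Finset.univ : Finset (Fin m)) = s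
  induction s using Finset.induction_on with
  | empty => simpa using hom 0 0 (zero deg 0)
  | insert a s ha ih => rw [Finset.sum_insert ha]; exact add _ _ (single a _) ih

theorem add_right_iff (d : ℕ) :
    IsHomogeneousVector (fun a => deg a + d) (j + d) v ↔ IsHomogeneousVector deg j v := by
  simp [IsHomogeneousVector, Nat.add_sub_add_right]

theorem eq_zero_of_lt {d : ℕ} (h : IsHomogeneousVector (fun a => deg a + d) j v) (hj : j < d) :
    v = 0 :=
  funext fun a => (h a).2 (by dsimp only; omega)

theorem constantCoeff_eq_zero (h : IsHomogeneousVector deg j v) {a : Fin m} (ha : deg a ≠ j) :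
    constantCoeff (v a) = 0 := by
  rcases lt_or_gt_of_ne ha with h' | h'
  · rw [constantCoeff_eq]
    exact ((h a).1 h'.le).coeff_eq_zero (by simp; omega)
  · simp [(h a).2 h']

theorem append {m' : ℕ} {deg' : Fin m' → ℕ} {w : Fin m' → MvPolynomial σ k}
    (hv : IsHomogeneousVector deg j v) (hw : IsHomogeneousVector deg' j w) :
    IsHomogeneousVector (Fin.append deg deg') j (Fin.append v w) := fun a => by
  refine Fin.addCases (fun a => ?_) (fun a => ?_) a
  · simpa using hv a
  · simpa using hw a

end IsHomogeneousVector

/-- The degree `j` component of a vector of a graded free module. -/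
noncomputable def vectorComponent {m : ℕ} (deg : Fin m → ℕ) (j : ℕ) :
    (Fin m → MvPolynomial σ k) →ₗ[k] (Fin m → MvPolynomial σ k) :=
  LinearMap.pi fun a => if deg a ≤ j then homogeneousComponent (j - deg a) ∘ₗ LinearMap.proj a else 0

theorem vectorComponent_isHomogeneousVector {m : ℕ} (deg : Fin m → ℕ) (j : ℕ)
    (v : Fin m → MvPolynomial σ k) : IsHomogeneousVector deg j (vectorComponent deg j v) := fun a => by
  refine ⟨fun h => ?_, fun h => ?_⟩
  · simpa [vectorComponent, h] using homogeneousComponent_isHomogeneous _ _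
  · simp [vectorComponent, not_le.2 h]

theorem IsHomogeneousVector.vectorComponent_eq {m : ℕ} {deg : Fin m → ℕ} {j : ℕ}
    {v : Fin m → MvPolynomial σ k} (h : IsHomogeneousVector deg j v) (t : ℕ) :
    vectorComponent deg t v = if t = j then v else 0 := by
  funext a
  by_cases hj : deg a ≤ j
  · by_cases ht : deg a ≤ t
    · have : t - deg a = j - deg a ↔ t = j := by omega
      simp only [vectorComponent, ht, if_true, LinearMap.pi_apply, LinearMap.comp_apply,
        LinearMap.proj_apply, homogeneousComponent_of_mem ((h a).1 hj), this]
      split_ifs <;> rfl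
    · have : t ≠ j := by omega
      simp [vectorComponent, ht, this]
  · have h0 : v a = 0 := (h a).2 (by omega)
    have : vectorComponent deg t v a = 0 := by
      simp only [vectorComponent, LinearMap.pi_apply]
      split_ifs <;> simp [h0]
    rw [this]
    split_ifs <;> simp [h0]

/-- A linear map of graded free modules which is homogeneous of degree `0`. -/
def IsHomogeneousMap {m m' : ℕ} (deg : Fin m → ℕ) (deg' : Fin m' → ℕ)
    (φ : (Fin m → MvPolynomial σ k) →ₗ[MvPolynomial σ k] (Fin m' → MvPolynomial σ k)) : Prop :=
  ∀ j v, IsHomogeneousVector deg j v → IsHomogeneousVector deg' j (φ v)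

/-- This allows an arbitrary preimage under a homogeneous map to be replaced by its component of the
right degree, so lifts can be chosen homogeneous. -/
theorem IsHomogeneousMap.vectorComponent_comm {m m' : ℕ} {deg : Fin m → ℕ} {deg' : Fin m' → ℕ}
    {φ : (Fin m → MvPolynomial σ k) →ₗ[MvPolynomial σ k] (Fin m' → MvPolynomial σ k)}
    (h : IsHomogeneousMap deg deg' φ) (j : ℕ) (v : Fin m → MvPolynomial σ k) :
    vectorComponent deg' j (φ v) = φ (vectorComponent deg j v) := by
  induction v using IsHomogeneousVector.induction deg with
  | hom t v hv => rw [(h t v hv).vectorComponent_eq, hv.vectorComponent_eq]; split_ifs <;> simp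
  | add v w hv hw => simp [hv, hw]

theorem IsHomogeneousMap.comp {m m' m'' : ℕ} {deg : Fin m → ℕ} {deg' : Fin m' → ℕ}
    {deg'' : Fin m'' → ℕ}
    {φ : (Fin m → MvPolynomial σ k) →ₗ[MvPolynomial σ k] (Fin m' → MvPolynomial σ k)}
    {ψ : (Fin m' → MvPolynomial σ k) →ₗ[MvPolynomial σ k] (Fin m'' → MvPolynomial σ k)}
    (hψ : IsHomogeneousMap deg' deg'' ψ) (hφ : IsHomogeneousMap deg deg' φ) :
    IsHomogeneousMap deg deg'' (ψ ∘ₗ φ) := fun j v hv => hψ j _ (hφ j v hv)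

theorem IsHomogeneousMap.add_right {m m' : ℕ} {deg : Fin m → ℕ} {deg' : Fin m' → ℕ}
    {φ : (Fin m → MvPolynomial σ k) →ₗ[MvPolynomial σ k] (Fin m' → MvPolynomial σ k)}
    (h : IsHomogeneousMap deg deg' φ) (d : ℕ) :
    IsHomogeneousMap (fun a => deg a + d) (fun a => deg' a + d) φ := fun j v hv => by
  by_cases hj : j < d
  · rw [hv.eq_zero_of_lt hj, map_zero]
    exact .zero _ _
  · obtain ⟨j, rfl⟩ := Nat.exists_eq_add_of_le' (not_lt.1 hj)
    rw [IsHomogeneousVector.add_right_iff] at hv ⊢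
    exact h j v hv

theorem linearMap_apply_eq_sum_single {m : ℕ} {M : Type*} [AddCommGroup M]
    [Module (MvPolynomial σ k) M] (φ : (Fin m → MvPolynomial σ k) →ₗ[MvPolynomial σ k] M)
    (v : Fin m → MvPolynomial σ k) : φ v = ∑ a, v a • φ (Pi.single a 1) := by
  conv_lhs => rw [← Finset.univ_sum_single v]
  rw [map_sum]
  refine Finset.sum_congr rfl fun a _ => ?_
  rw [← map_smul, ← Pi.single_smul]
  simp

theorem isHomogeneousMap_of_single {m m' : ℕ} {deg : Fin m → ℕ} {deg' : Fin m' → ℕ}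
    {φ : (Fin m → MvPolynomial σ k) →ₗ[MvPolynomial σ k] (Fin m' → MvPolynomial σ k)}
    (h : ∀ a, IsHomogeneousVector deg' (deg a) (φ (Pi.single a 1))) :
    IsHomogeneousMap deg deg' φ := fun j v hv => by
  rw [linearMap_apply_eq_sum_single]
  refine .sum _ _ fun a _ => ?_
  by_cases hj : deg a ≤ j
  · simpa [hj] using ((h a).smul ((hv a).1 hj))
  · rw [(hv a).2 (by omega), zero_smul]
    exact .zero _ _

/-- A map out of a graded free module is determined on the basis by homogeneous elements of the
right degrees. -/
theorem exists_homogeneousMap {m m' : ℕ} {M : Type*} [AddCommGroup M] [Module (MvPolynomial σ k) M]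
    (deg : Fin m → ℕ) (deg' : Fin m' → ℕ)
    (p : (Fin m' → MvPolynomial σ k) →ₗ[MvPolynomial σ k] M)
    (ψ : (Fin m → MvPolynomial σ k) →ₗ[MvPolynomial σ k] M)
    (h : ∀ a, ∃ v, IsHomogeneousVector deg' (deg a) v ∧ p v = ψ (Pi.single a 1)) :
    ∃ φ : (Fin m → MvPolynomial σ k) →ₗ[MvPolynomial σ k] (Fin m' → MvPolynomial σ k),
      IsHomogeneousMap deg deg' φ ∧ p ∘ₗ φ = ψ := by
  choose v hv hp using h
  have hs (a : Fin m) : (Fintype.linearCombination (MvPolynomial σ k) v) (Pi.single a 1) = v a := by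
    simp
  refine ⟨Fintype.linearCombination _ v, isHomogeneousMap_of_single fun a => ?_, ?_⟩
  · rw [hs]
    exact hv a
  · refine LinearMap.pi_ext' fun a => LinearMap.ext_ring ?_
    simp [hp]

/-- Lifting of a homogeneous map along a homogeneous map. -/
theorem exists_homogeneous_lift {m m' l : ℕ} {deg : Fin m → ℕ} {deg' : Fin m' → ℕ}
    {deg'' : Fin l → ℕ}
    {p : (Fin m' → MvPolynomial σ k) →ₗ[MvPolynomial σ k] (Fin l → MvPolynomial σ k)}
    {ψ : (Fin m → MvPolynomial σ k) →ₗ[MvPolynomial σ k] (Fin l → MvPolynomial σ k)}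
    (hp : IsHomogeneousMap deg' deg'' p) (hψ : IsHomogeneousMap deg deg'' ψ)
    (h : ∀ v, ψ v ∈ LinearMap.range p) :
    ∃ φ : (Fin m → MvPolynomial σ k) →ₗ[MvPolynomial σ k] (Fin m' → MvPolynomial σ k),
      IsHomogeneousMap deg deg' φ ∧ p ∘ₗ φ = ψ := by
  refine exists_homogeneousMap deg deg' p ψ fun a => ?_
  obtain ⟨v, hv⟩ := h (Pi.single a 1)
  refine ⟨vectorComponent deg' (deg a) v, vectorComponent_isHomogeneousVector _ _ _, ?_⟩
  rw [← hp.vectorComponent_comm, hv, (hψ _ _ (.single_one deg a)).vectorComponent_eq, if_pos rfl]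

end HomogeneousVector

/-! ### The ideal of the variables, detected by constant coefficients. -/

section MaximalIdeal

variable {k σ : Type*} [Field k]

theorem mem_span_range_X_iff {f : MvPolynomial σ k} :
    f ∈ Ideal.span (Set.range (X : σ → MvPolynomial σ k)) ↔ constantCoeff f = 0 := by
  rw [← Set.image_univ, mem_ideal_span_X_image, constantCoeff_eq]
  constructor
  · intro h
    by_contra h0
    obtain ⟨i, -, hi⟩ := h 0 (by simpa using h0)
    simp at hi
  · intro h m hm
    by_contra! h'
    have : m = 0 := Finsupp.ext fun i => h' i trivial
    subst this
    simp [h] at hm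

theorem mem_span_range_X_smul_top_iff {m : ℕ} {v : Fin m → MvPolynomial σ k} :
    v ∈ Ideal.span (Set.range (X : σ → MvPolynomial σ k)) •
      (⊤ : Submodule (MvPolynomial σ k) (Fin m → MvPolynomial σ k)) ↔
    ∀ a, constantCoeff (v a) = 0 := by
  constructor
  · intro h a
    rw [← mem_span_range_X_iff]
    refine Submodule.smul_induction_on h (fun f hf w _ => ?_) fun v w hv hw => ?_
    · exact Ideal.mul_mem_right _ _ hf
    · exact add_mem hv hw
  · intro h
    rw [← Finset.univ_sum_single v]
    refine Submodule.sum_mem _ fun a _ => ?_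
    have : Pi.single a (v a) = v a • (Pi.single a 1 : Fin m → MvPolynomial σ k) := by
      rw [← Pi.single_smul]; simp
    rw [this]
    exact Submodule.smul_mem_smul (mem_span_range_X_iff.2 (h a)) trivial

end MaximalIdeal

/-- Dependent choice for building chain maps and homotopies degree by degree: `P` records that the
next lifting problem is solvable, `Q` the commutation relation between consecutive terms. -/
theorem exists_dependent_sequence {T : ℕ → Type*} (P : ∀ i, T i → Prop)
    (Q : ∀ i, T i → T (i + 1) → Prop) (x₀ : T 0) (h₀ : P 0 x₀)
    (step : ∀ i x, P i x → ∃ y, P (i + 1) y ∧ Q i x y) :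
    ∃ s : ∀ i, T i, s 0 = x₀ ∧ (∀ i, P i (s i)) ∧ ∀ i, Q i (s i) (s (i + 1)) := by
  choose next hP hQ using step
  let s : ∀ i, {x : T i // P i x} := fun i =>
    Nat.rec ⟨x₀, h₀⟩ (fun i x => ⟨next i x.1 x.2, hP i x.1 x.2⟩) i
  exact ⟨fun i => (s i).1, rfl, fun i => (s i).2, fun i => hQ i _ (s i).2⟩

/-! ### Comparison of resolutions and uniqueness of Betti numbers. -/

section Comparison

variable {k σ : Type*} [Field k]

/-- An ideal of the polynomial ring which contains the homogeneous components of its elements. -/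
def IsHomogeneousIdeal (I : Ideal (MvPolynomial σ k)) : Prop :=
  ∀ g ∈ I, ∀ j, homogeneousComponent j g ∈ I

variable {I J : Ideal (MvPolynomial σ k)}

namespace MinimalGradedFreeResolution

theorem ε_d (F : MinimalGradedFreeResolution I) (v) : F.ε (F.d 0 v) = 0 :=
  F.exact_zero.apply_apply_eq_zero v

theorem d_d (F : MinimalGradedFreeResolution I) (i : ℕ) (v) : F.d i (F.d (i + 1) v) = 0 :=
  (F.exact_succ i).apply_apply_eq_zero v

theorem constantCoeff_d (F : MinimalGradedFreeResolution I) (i : ℕ) (v) (a) :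
    constantCoeff (F.d i v a) = 0 :=
  mem_span_range_X_smul_top_iff.1 (F.minimal i (LinearMap.mem_range_self _ v)) a

/-- The quotient R/I is given no grading here, so components are taken on a representative `g`;
homogeneity of `I` makes the choice harmless. -/
theorem ε_vectorComponent (F : MinimalGradedFreeResolution I) (hI : IsHomogeneousIdeal I) (j : ℕ)
    (v : Fin (F.rank 0) → MvPolynomial σ k) (g : MvPolynomial σ k)
    (h : F.ε v = Ideal.Quotient.mk I g) :
    F.ε (vectorComponent (F.deg 0) j v) = Ideal.Quotient.mk I (homogeneousComponent j g) := by
  induction v using IsHomogeneousVector.induction (F.deg 0) generalizing g with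
  | hom t v hv =>
    obtain ⟨u, hu, huv⟩ := F.ε_homogeneous t v hv
    have h1 : homogeneousComponent j (u - g) ∈ I :=
      hI _ (Ideal.Quotient.eq.1 (huv.trans h)) j
    rw [map_sub, ← Ideal.Quotient.eq] at h1
    rw [← h1, homogeneousComponent_of_mem hu, hv.vectorComponent_eq]
    split_ifs
    · exact huv.symm
    · simp
  | add v w hv hw =>
    obtain ⟨u, hu⟩ := Ideal.Quotient.mk_surjective (F.ε v)
    have hw' : F.ε w = Ideal.Quotient.mk I (g - u) := by
      rw [map_sub, hu, ← h, map_add]; abel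
    rw [map_add, map_add, hv u hu.symm, hw _ hw', ← map_add, ← map_add]
    congr 2
    abel

theorem exists_homogeneous_preimage (F : MinimalGradedFreeResolution I)
    (hI : IsHomogeneousIdeal I) {j : ℕ} {g : MvPolynomial σ k} (hg : g.IsHomogeneous j) :
    ∃ v, IsHomogeneousVector (F.deg 0) j v ∧ F.ε v = Ideal.Quotient.mk I g := by
  obtain ⟨v, hv⟩ := F.ε_surjective (Ideal.Quotient.mk I g)
  refine ⟨_, vectorComponent_isHomogeneousVector _ j v, ?_⟩
  rw [F.ε_vectorComponent hI j v g hv, homogeneousComponent_of_mem hg, if_pos rfl]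

/-- Multiplication by a homogeneous `f` with `f J ⊆ I`, as a map `R ⧸ J → R ⧸ I`, lifts to a
homogeneous map of resolutions. -/
theorem exists_chainMap (F : MinimalGradedFreeResolution I) (G : MinimalGradedFreeResolution J)
    (hI : IsHomogeneousIdeal I) {f : MvPolynomial σ k} {d : ℕ} (hf : f.IsHomogeneous d)
    (hJ : ∀ g ∈ J, f * g ∈ I) :
    ∃ φ : ∀ i, (Fin (G.rank i) → MvPolynomial σ k) →ₗ[MvPolynomial σ k]
        (Fin (F.rank i) → MvPolynomial σ k),
      (∀ i, IsHomogeneousMap (fun a => G.deg i a + d) (F.deg i) (φ i)) ∧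
      (∀ x g, G.ε x = Ideal.Quotient.mk J g → F.ε (φ 0 x) = Ideal.Quotient.mk I (f * g)) ∧
      ∀ i, F.d i ∘ₗ φ (i + 1) = φ i ∘ₗ G.d i := by
  let α : (MvPolynomial σ k ⧸ J) →ₗ[MvPolynomial σ k] (MvPolynomial σ k ⧸ I) :=
    Submodule.mapQ J I (LinearMap.mulLeft _ f) hJ
  have hα (g : MvPolynomial σ k) : α (Ideal.Quotient.mk J g) = Ideal.Quotient.mk I (f * g) := rfl
  obtain ⟨φ₀, hφ₀, hε⟩ := exists_homogeneousMap (fun a => G.deg 0 a + d) (F.deg 0) F.ε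
    (α ∘ₗ G.ε) fun a => by
      obtain ⟨g, hg, hga⟩ := G.ε_homogeneous _ _ (IsHomogeneousVector.single_one (G.deg 0) a)
      obtain ⟨v, hv, hvg⟩ := F.exists_homogeneous_preimage hI (hf.mul hg)
      refine ⟨v, by rwa [add_comm], ?_⟩
      rw [hvg, LinearMap.comp_apply, ← hga, hα]
  have hε' (x) : F.ε (φ₀ x) = α (G.ε x) := LinearMap.congr_fun hε x
  obtain ⟨φ, rfl, hφ, hd⟩ := exists_dependent_sequence
    (T := fun i => (Fin (G.rank i) → MvPolynomial σ k) →ₗ[MvPolynomial σ k]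
        (Fin (F.rank i) → MvPolynomial σ k))
    (fun i φ => IsHomogeneousMap (fun a => G.deg i a + d) (F.deg i) φ ∧
      ∀ v, φ (G.d i v) ∈ LinearMap.range (F.d i))
    (fun i φ φ' => F.d i ∘ₗ φ' = φ ∘ₗ G.d i) φ₀
    ⟨hφ₀, fun v => (F.exact_zero _).1 (by rw [hε', G.ε_d, map_zero])⟩
    (fun i φ h => by
      obtain ⟨φ', h1, h2⟩ := exists_homogeneous_lift (F.d_homogeneous i)
        (h.1.comp (IsHomogeneousMap.add_right (G.d_homogeneous i) d)) h.2
      refine ⟨φ', ⟨h1, fun v => (F.exact_succ i _).1 ?_⟩, h2⟩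
      rw [← LinearMap.comp_apply, h2, LinearMap.comp_apply, G.d_d, map_zero])
  exact ⟨φ, fun i => (hφ i).1, fun x g h => by rw [hε', h, hα], hd⟩

/-- A chain map from a resolution to itself which lifts zero is null-homotopic. -/
theorem exists_homotopy (F : MinimalGradedFreeResolution I)
    (χ : ∀ i, (Fin (F.rank i) → MvPolynomial σ k) →ₗ[MvPolynomial σ k]
        (Fin (F.rank i) → MvPolynomial σ k))
    (hε : ∀ v, F.ε (χ 0 v) = 0) (hχ : ∀ i, F.d i ∘ₗ χ (i + 1) = χ i ∘ₗ F.d i) :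
    ∃ h : ∀ i, (Fin (F.rank i) → MvPolynomial σ k) →ₗ[MvPolynomial σ k]
        (Fin (F.rank (i + 1)) → MvPolynomial σ k),
      F.d 0 ∘ₗ h 0 = χ 0 ∧ ∀ i, F.d (i + 1) ∘ₗ h (i + 1) = χ (i + 1) - h i ∘ₗ F.d i := by
  have lift (i l : ℕ) (ψ : (Fin (F.rank l) → MvPolynomial σ k) →ₗ[MvPolynomial σ k]
      (Fin (F.rank i) → MvPolynomial σ k)) (h : ∀ v, ψ v ∈ LinearMap.range (F.d i)) :
      ∃ φ, F.d i ∘ₗ φ = ψ := by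
    choose v hv using h
    refine ⟨Fintype.linearCombination _ fun a => v (Pi.single a 1), ?_⟩
    refine LinearMap.pi_ext' fun a => LinearMap.ext_ring ?_
    simp [hv]
  obtain ⟨h₀, hh₀⟩ := lift 0 0 (χ 0) fun v => (F.exact_zero _).1 (hε v)
  have hχ' (i v) : F.d i (χ (i + 1) v) = χ i (F.d i v) := LinearMap.congr_fun (hχ i) v
  have hh₀' (v) : F.d 0 (h₀ v) = χ 0 v := LinearMap.congr_fun hh₀ v
  obtain ⟨h, rfl, -, hh⟩ := exists_dependent_sequence
    (T := fun i => (Fin (F.rank i) → MvPolynomial σ k) →ₗ[MvPolynomial σ k]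
        (Fin (F.rank (i + 1)) → MvPolynomial σ k))
    (fun i h => ∀ v, (χ (i + 1) - h ∘ₗ F.d i) v ∈ LinearMap.range (F.d (i + 1)))
    (fun i h h' => F.d (i + 1) ∘ₗ h' = χ (i + 1) - h ∘ₗ F.d i) h₀
    (fun v => (F.exact_succ 0 _).1 (by simp [hχ', hh₀']))
    (fun i h hi => by
      obtain ⟨h', hh'⟩ := lift (i + 1) (i + 1) _ hi
      have hh'' (v) : F.d (i + 1) (h' v) = χ (i + 1) v - h (F.d i v) := LinearMap.congr_fun hh' v
      exact ⟨h', fun v => (F.exact_succ (i + 1) _).1 (by simp [hχ', hh'', F.d_d]), hh'⟩)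
  exact ⟨h, hh₀, hh⟩

/-- Such a map has the form dh + hd, and both terms have entries in the ideal of the variables
because d does. -/
theorem constantCoeff_of_lifts_zero (F : MinimalGradedFreeResolution I)
    (χ : ∀ i, (Fin (F.rank i) → MvPolynomial σ k) →ₗ[MvPolynomial σ k]
        (Fin (F.rank i) → MvPolynomial σ k))
    (hε : ∀ v, F.ε (χ 0 v) = 0) (hχ : ∀ i, F.d i ∘ₗ χ (i + 1) = χ i ∘ₗ F.d i) (i : ℕ) (v) (a) :
    constantCoeff (χ i v a) = 0 := by
  obtain ⟨h, h0, hs⟩ := F.exists_homotopy χ hε hχ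
  cases i with
  | zero => rw [← h0]; exact F.constantCoeff_d _ _ _
  | succ i =>
    have : χ (i + 1) v = F.d (i + 1) (h (i + 1) v) + h i (F.d i v) := by
      have := LinearMap.congr_fun (hs i) v
      simp only [LinearMap.comp_apply, LinearMap.sub_apply] at this
      rw [this, sub_add_cancel]
    rw [this, Pi.add_apply, map_add, F.constantCoeff_d, zero_add, linearMap_apply_eq_sum_single,
      Finset.sum_apply, map_sum]
    exact Finset.sum_eq_zero fun b _ => by simp [F.constantCoeff_d]

/-- Modulo the variables, the composite of the two lifts of the identity is the identity. Its block
in degree j factors through the degree j basis elements of G, which forces the inequality of ranks.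
-/
theorem betti_le (hI : IsHomogeneousIdeal I) (F G : MinimalGradedFreeResolution I) (i j : ℕ) :
    F.betti i j ≤ G.betti i j := by
  obtain ⟨φ, hφ, hφε, hφd⟩ := G.exists_chainMap F hI (isHomogeneous_one σ k) (by simp)
  obtain ⟨ψ, hψ, hψε, hψd⟩ := F.exists_chainMap G hI (isHomogeneous_one σ k) (by simp)
  have key := F.constantCoeff_of_lifts_zero (fun i => ψ i ∘ₗ φ i - LinearMap.id) (fun v => by
      obtain ⟨g, hg⟩ := Ideal.Quotient.mk_surjective (F.ε v)
      have h1 := hφε v g hg.symm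
      have h2 := hψε _ _ h1
      simp [h2, ← hg]) (fun i => by
      rw [LinearMap.comp_sub, LinearMap.sub_comp, LinearMap.comp_id, LinearMap.id_comp,
        ← LinearMap.comp_assoc, hψd, LinearMap.comp_assoc, hφd, LinearMap.comp_assoc]) i
  let A : Matrix {c // G.deg i c = j} {b // F.deg i b = j} k := Matrix.of fun c b =>
    constantCoeff (φ i (Pi.single b.1 1) c.1)
  let B : Matrix {b // F.deg i b = j} {c // G.deg i c = j} k := Matrix.of fun a c =>
    constantCoeff (ψ i (Pi.single c.1 1) a.1)
  have hBA : B * A = 1 := by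
    ext a b
    have h1 := key (Pi.single b.1 1) a.1
    rw [LinearMap.sub_apply, LinearMap.id_apply, Pi.sub_apply, map_sub, sub_eq_zero,
      LinearMap.comp_apply, linearMap_apply_eq_sum_single, Finset.sum_apply, map_sum] at h1
    have h2 : (constantCoeff ((Pi.single b.1 1 : Fin (F.rank i) → MvPolynomial σ k) a.1) : k) =
        (1 : Matrix _ _ k) a b := by
      by_cases h : a = b
      · subst h; simp
      · rw [Matrix.one_apply_ne h, Pi.single_eq_of_ne (fun h' => h (Subtype.ext h')), map_zero]
    rw [← h2, ← h1, Matrix.mul_apply]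
    -- Basis elements of G of another degree drop out: an entry of a degree 0 map between generators
    -- of different degrees has no constant term.
    rw [← Finset.sum_subset (Finset.filter_subset (fun c => G.deg i c = j) Finset.univ)]
    · rw [Finset.sum_subtype (p := fun c => G.deg i c = j) _ (by simp)]
      refine Finset.sum_congr rfl fun c _ => ?_
      simp [A, B, mul_comm]
    · intro c _ hc
      have : G.deg i c ≠ F.deg i b.1 := by simpa [b.2] using hc
      have := (hφ i _ _ (IsHomogeneousVector.single_one _ b.1)).constantCoeff_eq_zero this
      simp [this]
  have hinj : Function.Injective A.mulVecLin := by
    intro x y hxy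
    have := congrArg (B.mulVec) hxy
    simpa [hBA] using this
  have := LinearMap.finrank_le_finrank_of_injective hinj
  simpa [betti, Fintype.card_subtype] using this

theorem betti_eq (hI : IsHomogeneousIdeal I) (F G : MinimalGradedFreeResolution I) (i j : ℕ) :
    F.betti i j = G.betti i j :=
  le_antisymm (betti_le hI F G i j) (betti_le hI G F i j)

end MinimalGradedFreeResolution

end Comparison

/-! ### Mapping cones. -/

section Cone

variable {k σ : Type*} [Field k]

/-- The map `M → R ^ (a + b)` with given components `M → R ^ a` and `M → R ^ b`. -/
def appendLinearMap {R M : Type*} [CommRing R] [AddCommGroup M] [Module R M] {a b : ℕ}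
    (p : M →ₗ[R] (Fin a → R)) (q : M →ₗ[R] (Fin b → R)) : M →ₗ[R] (Fin (a + b) → R) where
  toFun v := Fin.append (p v) (q v)
  map_add' v w := by
    ext c
    refine Fin.addCases (fun c => ?_) (fun c => ?_) c <;> simp
  map_smul' r v := by
    ext c
    refine Fin.addCases (fun c => ?_) (fun c => ?_) c <;> simp

/-- The projection `R ^ (a + b) → R ^ a`. -/
def appendFst (R : Type*) [CommRing R] (a b : ℕ) : (Fin (a + b) → R) →ₗ[R] (Fin a → R) :=
  LinearMap.funLeft R R (Fin.castAdd b)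

/-- The projection `R ^ (a + b) → R ^ b`. -/
def appendSnd (R : Type*) [CommRing R] (a b : ℕ) : (Fin (a + b) → R) →ₗ[R] (Fin b → R) :=
  LinearMap.funLeft R R (Fin.natAdd a)

@[simp] theorem appendFst_append {R : Type*} [CommRing R] {a b : ℕ} (v : Fin a → R)
    (w : Fin b → R) : appendFst R a b (Fin.append v w) = v := by
  ext c; simp [appendFst, LinearMap.funLeft]

@[simp] theorem appendSnd_append {R : Type*} [CommRing R] {a b : ℕ} (v : Fin a → R)
    (w : Fin b → R) : appendSnd R a b (Fin.append v w) = w := by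
  ext c; simp [appendSnd, LinearMap.funLeft]

theorem append_fst_snd {R : Type*} [CommRing R] {a b : ℕ} (v : Fin (a + b) → R) :
    Fin.append (appendFst R a b v) (appendSnd R a b v) = v := by
  ext c
  refine Fin.addCases (fun c => ?_) (fun c => ?_) c <;>
    simp [appendFst, appendSnd, LinearMap.funLeft]

theorem append_eq_zero_iff {R : Type*} [CommRing R] {a b : ℕ} {v : Fin a → R} {w : Fin b → R} :
    Fin.append v w = 0 ↔ v = 0 ∧ w = 0 := by
  constructor
  · intro h
    exact ⟨by rw [← appendFst_append v w, h, map_zero], by rw [← appendSnd_append v w, h, map_zero]⟩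
  · rintro ⟨rfl, rfl⟩
    ext c
    refine Fin.addCases (fun c => ?_) (fun c => ?_) c <;> simp

/-- The differential of a mapping cone: `(x, y) ↦ (d x + φ y, - e y)`. -/
def coneMap {R : Type*} [CommRing R] {a₂ a₁ b₁ b₀ : ℕ} (d : (Fin a₂ → R) →ₗ[R] (Fin a₁ → R))
    (e : (Fin b₁ → R) →ₗ[R] (Fin b₀ → R)) (φ : (Fin b₁ → R) →ₗ[R] (Fin a₁ → R)) :
    (Fin (a₂ + b₁) → R) →ₗ[R] (Fin (a₁ + b₀) → R) :=
  appendLinearMap (d ∘ₗ appendFst _ _ _ + φ ∘ₗ appendSnd _ _ _) (-(e ∘ₗ appendSnd _ _ _))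

theorem coneMap_apply {R : Type*} [CommRing R] {a₂ a₁ b₁ b₀ : ℕ}
    (d : (Fin a₂ → R) →ₗ[R] (Fin a₁ → R)) (e : (Fin b₁ → R) →ₗ[R] (Fin b₀ → R))
    (φ : (Fin b₁ → R) →ₗ[R] (Fin a₁ → R)) (w) :
    coneMap d e φ w = Fin.append (d (appendFst R a₂ b₁ w) + φ (appendSnd R a₂ b₁ w))
      (-e (appendSnd R a₂ b₁ w)) := rfl

/-- A diagram chase. Only the kernel of the outgoing map `p` is prescribed, so that the same
argument covers the spot next to the augmentation, where `e'` is the augmentation of G and not a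
differential. -/
theorem exact_coneMap {R M N : Type*} [CommRing R] [AddCommGroup M] [Module R M] [AddCommGroup N]
    [Module R N] {a₂ a₁ a₀ b₁ b₀ : ℕ} {d : (Fin a₂ → R) →ₗ[R] (Fin a₁ → R)}
    {d' : (Fin a₁ → R) →ₗ[R] (Fin a₀ → R)} {e : (Fin b₁ → R) →ₗ[R] (Fin b₀ → R)}
    {e' : (Fin b₀ → R) →ₗ[R] N} {φ : (Fin b₁ → R) →ₗ[R] (Fin a₁ → R)}
    {φ' : (Fin b₀ → R) →ₗ[R] (Fin a₀ → R)} (hd : Function.Exact d d') (he : Function.Exact e e')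
    (hφ : ∀ y, d' (φ y) = φ' (e y)) (p : (Fin (a₁ + b₀) → R) →ₗ[R] M)
    (hp : ∀ w, p w = 0 ↔
      d' (appendFst R a₁ b₀ w) + φ' (appendSnd R a₁ b₀ w) = 0 ∧ e' (appendSnd R a₁ b₀ w) = 0) :
    Function.Exact (coneMap d e φ) p := by
  intro w
  rw [hp]
  constructor
  · rintro ⟨h1, h2⟩
    obtain ⟨y, hy⟩ := (he _).1 h2
    obtain ⟨x, hx⟩ := (hd (appendFst R a₁ b₀ w + φ y)).1 (by rw [map_add, hφ, hy, h1])
    refine ⟨Fin.append x (-y), ?_⟩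
    rw [coneMap_apply, appendFst_append, appendSnd_append, map_neg, map_neg, neg_neg, hx, hy,
      add_neg_cancel_right, append_fst_snd]
  · rintro ⟨v, rfl⟩
    simp [coneMap_apply, hφ, hd.apply_apply_eq_zero, he.apply_apply_eq_zero]

theorem IsHomogeneousVector.fst {a b : ℕ} {deg : Fin a → ℕ} {deg' : Fin b → ℕ} {j : ℕ}
    {v : Fin (a + b) → MvPolynomial σ k} (h : IsHomogeneousVector (Fin.append deg deg') j v) :
    IsHomogeneousVector deg j (appendFst _ a b v) := fun c => by
  simpa [appendFst, LinearMap.funLeft] using h (Fin.castAdd b c)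

theorem IsHomogeneousVector.snd {a b : ℕ} {deg : Fin a → ℕ} {deg' : Fin b → ℕ} {j : ℕ}
    {v : Fin (a + b) → MvPolynomial σ k} (h : IsHomogeneousVector (Fin.append deg deg') j v) :
    IsHomogeneousVector deg' j (appendSnd _ a b v) := fun c => by
  simpa [appendSnd, LinearMap.funLeft] using h (Fin.natAdd a c)

namespace MinimalGradedFreeResolution

variable {I J : Ideal (MvPolynomial σ k)}

/-- The ranks of the mapping cone. -/
def coneRank (F : MinimalGradedFreeResolution I) (G : MinimalGradedFreeResolution J) : ℕ → ℕ
  | 0 => F.rank 0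
  | i + 1 => F.rank (i + 1) + G.rank i

/-- The degrees of the basis elements of the mapping cone of a map `G(-d) → F`. -/
def coneDeg (F : MinimalGradedFreeResolution I) (G : MinimalGradedFreeResolution J) (d : ℕ) :
    ∀ i, Fin (coneRank F G i) → ℕ
  | 0 => F.deg 0
  | i + 1 => Fin.append (F.deg (i + 1)) fun a => G.deg i a + d

/-- The differential of the mapping cone. -/
noncomputable def coneD (F : MinimalGradedFreeResolution I) (G : MinimalGradedFreeResolution J)
    (φ : ∀ i, (Fin (G.rank i) → MvPolynomial σ k) →ₗ[MvPolynomial σ k]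
      (Fin (F.rank i) → MvPolynomial σ k)) :
    ∀ i, (Fin (coneRank F G (i + 1)) → MvPolynomial σ k) →ₗ[MvPolynomial σ k]
      (Fin (coneRank F G i) → MvPolynomial σ k)
  | 0 => F.d 0 ∘ₗ appendFst _ _ _ + φ 0 ∘ₗ appendSnd _ _ _
  | i + 1 => coneMap (F.d (i + 1)) (G.d i) (φ (i + 1))

/-- The augmentation of the mapping cone. -/
noncomputable def coneε (F : MinimalGradedFreeResolution I) (f : MvPolynomial σ k) :
    (Fin (F.rank 0) → MvPolynomial σ k) →ₗ[MvPolynomial σ k]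
      (MvPolynomial σ k ⧸ (I ⊔ Ideal.span {f})) :=
  Submodule.factor (le_sup_left : I ≤ I ⊔ Ideal.span {f}) ∘ₗ F.ε

theorem coneε_apply (F : MinimalGradedFreeResolution I) (f : MvPolynomial σ k) {v}
    {g : MvPolynomial σ k} (h : F.ε v = Ideal.Quotient.mk I g) :
    coneε F f v = Ideal.Quotient.mk (I ⊔ Ideal.span {f}) g := by
  rw [coneε, LinearMap.comp_apply, h]
  rfl

theorem coneε_surjective (F : MinimalGradedFreeResolution I) (f : MvPolynomial σ k) :
    Function.Surjective (coneε F f) := fun x => by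
  obtain ⟨g, rfl⟩ := Ideal.Quotient.mk_surjective x
  obtain ⟨v, hv⟩ := F.ε_surjective (Ideal.Quotient.mk I g)
  exact ⟨v, coneε_apply F f hv⟩

/-- An element of I + (f) is f c modulo I; lifting c to G and subtracting its image under φ leaves
an element resolved by F. -/
theorem exact_coneε (F : MinimalGradedFreeResolution I) (G : MinimalGradedFreeResolution J)
    (f : MvPolynomial σ k)
    (φ : (Fin (G.rank 0) → MvPolynomial σ k) →ₗ[MvPolynomial σ k]
      (Fin (F.rank 0) → MvPolynomial σ k))
    (hε : ∀ x g, G.ε x = Ideal.Quotient.mk J g → F.ε (φ x) = Ideal.Quotient.mk I (f * g)) :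
    Function.Exact (F.d 0 ∘ₗ appendFst _ (F.rank 1) (G.rank 0) +
      φ ∘ₗ appendSnd _ (F.rank 1) (G.rank 0))
      (coneε F f) := by
  intro x
  obtain ⟨g, hg⟩ := Ideal.Quotient.mk_surjective (F.ε x)
  rw [coneε_apply F f hg.symm, Ideal.Quotient.eq_zero_iff_mem, sup_comm,
    Ideal.mem_span_singleton_sup]
  constructor
  · rintro ⟨c, i, hi, rfl⟩
    obtain ⟨y, hy⟩ := G.ε_surjective (Ideal.Quotient.mk J c)
    have h2 := hε y c hy
    obtain ⟨z, hz⟩ := (F.exact_zero (x - φ y)).1 (by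
      rw [map_sub, h2, ← hg, ← map_sub, Ideal.Quotient.eq_zero_iff_mem]
      convert hi using 1; ring)
    exact ⟨Fin.append z y, by simp [hz]⟩
  · rintro ⟨v, rfl⟩
    obtain ⟨c, hc⟩ := Ideal.Quotient.mk_surjective (G.ε (appendSnd _ _ _ v))
    have h2 := hε _ c hc.symm
    rw [LinearMap.add_apply, LinearMap.comp_apply, LinearMap.comp_apply, map_add, F.ε_d, h2,
      zero_add, Ideal.Quotient.eq] at hg
    exact ⟨c, g - f * c, hg, by ring⟩

/-- The mapping cone of a map `G(-d) → F` of resolutions which lifts the injection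
`f : R ⧸ (I : f) (-d) → R ⧸ I`. It resolves `R ⧸ (I + (f))`, and is minimal if the degrees in `G(-d)`
differ from those in `F`. -/
noncomputable def cone (F : MinimalGradedFreeResolution I) (G : MinimalGradedFreeResolution J)
    (f : MvPolynomial σ k) (d : ℕ) (hJ : ∀ g, g ∈ J ↔ f * g ∈ I)
    (hdeg : ∀ i a b, F.deg i a ≠ G.deg i b + d)
    (φ : ∀ i, (Fin (G.rank i) → MvPolynomial σ k) →ₗ[MvPolynomial σ k]
      (Fin (F.rank i) → MvPolynomial σ k))
    (hφ : ∀ i, IsHomogeneousMap (fun a => G.deg i a + d) (F.deg i) (φ i))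
    (hε : ∀ x g, G.ε x = Ideal.Quotient.mk J g → F.ε (φ 0 x) = Ideal.Quotient.mk I (f * g))
    (hd : ∀ i, F.d i ∘ₗ φ (i + 1) = φ i ∘ₗ G.d i) :
    MinimalGradedFreeResolution (I ⊔ Ideal.span {f}) where
  rank := coneRank F G
  deg := coneDeg F G d
  d := coneD F G φ
  ε := coneε F f
  d_homogeneous i j v hv := by
    cases i with
    | zero => exact (F.d_homogeneous _ _ _ hv.fst).add (hφ _ _ _ hv.snd)
    | succ i =>
      exact ((F.d_homogeneous _ _ _ hv.fst).add (hφ _ _ _ hv.snd)).append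
        (IsHomogeneousMap.add_right (G.d_homogeneous i) d _ _ hv.snd).neg
  ε_homogeneous j v hv := by
    obtain ⟨g, hg, hgv⟩ := F.ε_homogeneous j v hv
    exact ⟨g, hg, (coneε_apply F f hgv.symm).symm⟩
  ε_surjective := coneε_surjective F f
  exact_zero := exact_coneε F G f (φ 0) hε
  exact_succ i := by
    have hd' (i v) : F.d i (φ (i + 1) v) = φ i (G.d i v) := LinearMap.congr_fun (hd i) v
    cases i with
    | zero =>
      refine exact_coneMap (F.exact_succ 0) G.exact_zero (hd' 0)
        (F.d 0 ∘ₗ appendFst _ _ _ + φ 0 ∘ₗ appendSnd _ _ _) fun w => ⟨fun h => ⟨h, ?_⟩, fun h => h.1⟩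
      obtain ⟨c, hc⟩ := Ideal.Quotient.mk_surjective (G.ε (appendSnd _ _ _ w))
      have h2 := hε _ c hc.symm
      -- Multiplication by f is injective from R/J to R/I, by the colon condition `hJ`; this yields
      -- the second kernel condition.
      have h3 : F.ε (F.d 0 _ + φ 0 _) = F.ε 0 := congrArg F.ε h
      rw [map_add, F.ε_d, zero_add,
        map_zero, h2, Ideal.Quotient.eq_zero_iff_mem, ← hJ, ← Ideal.Quotient.eq_zero_iff_mem,
        hc] at h3
      exact h3
    | succ i =>
      refine exact_coneMap (F.exact_succ (i + 1)) (G.exact_succ i) (hd' (i + 1))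
        (coneMap (F.d (i + 1)) (G.d i) (φ (i + 1))) fun w => ?_
      rw [coneMap_apply, append_eq_zero_iff, neg_eq_zero]
  minimal i := by
    -- A nonzero constant entry of φ would join generators of equal degree, which `hdeg` excludes.
    have hφ0 (i v a) : constantCoeff (φ i v a) = 0 := by
      rw [linearMap_apply_eq_sum_single, Finset.sum_apply, map_sum]
      refine Finset.sum_eq_zero fun b _ => ?_
      have := (hφ i _ _ (IsHomogeneousVector.single_one _ b)).constantCoeff_eq_zero (hdeg i a b)
      simp [this]
    have h0 (i v w a) : constantCoeff ((F.d i v + φ i w) a) = 0 := by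
      rw [Pi.add_apply, map_add, F.constantCoeff_d, hφ0, add_zero]
    rintro _ ⟨v, rfl⟩
    rw [mem_span_range_X_smul_top_iff]
    cases i with
    | zero => exact h0 0 (appendFst _ _ _ v) (appendSnd _ _ _ v)
    | succ i =>
      intro a
      refine Fin.addCases (fun a => ?_) (fun a => ?_) a
      · refine Eq.trans ?_ (h0 (i + 1) (appendFst _ _ _ v) (appendSnd _ _ _ v) a)
        exact congrArg _ (Fin.append_left _ _ _)
      · refine Eq.trans (b := constantCoeff (- G.d i (appendSnd _ _ _ v) a)) ?_ ?_
        · exact congrArg _ (Fin.append_right _ _ _)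
        · rw [map_neg, G.constantCoeff_d, neg_zero]

theorem betti_eq_sum (F : MinimalGradedFreeResolution I) (i j : ℕ) :
    F.betti i j = ∑ a, if F.deg i a = j then 1 else 0 := by
  rw [betti, Finset.card_filter]

/-- The ranks in the resolution of `R ⧸ 0` by `R` itself. -/
def botRank : ℕ → ℕ
  | 0 => 1
  | _ + 1 => 0

/-- The resolution of `R ⧸ 0` by `R` itself. -/
noncomputable def ofBot : MinimalGradedFreeResolution (⊥ : Ideal (MvPolynomial σ k)) where
  rank := botRank
  deg _ _ := 0
  d _ := 0
  ε := Submodule.mkQ ⊥ ∘ₗ LinearMap.proj (0 : Fin 1)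
  d_homogeneous _ _ _ _ := .zero _ _
  ε_homogeneous j v hv := ⟨v (0 : Fin 1), (hv (0 : Fin 1)).1 (Nat.zero_le _), rfl⟩
  ε_surjective := (Submodule.mkQ_surjective _).comp fun g => ⟨fun _ => g, rfl⟩
  exact_zero v := by
    change Submodule.mkQ ⊥ (v (0 : Fin 1)) = 0 ↔ v ∈ Set.range (fun _ => 0)
    rw [← LinearMap.mem_ker, Submodule.ker_mkQ, Submodule.mem_bot]
    constructor
    · intro h
      refine ⟨0, funext fun a => ?_⟩
      have ha : a = (0 : Fin 1) := Subsingleton.elim (α := Fin 1) _ _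
      rw [ha, h]
      rfl
    · rintro ⟨-, rfl⟩
      rfl
  exact_succ i v := ⟨fun _ => ⟨0, funext fun a => Fin.elim0 a⟩, fun _ => rfl⟩
  minimal i := by
    rintro _ ⟨v, rfl⟩
    exact zero_mem _

end MinimalGradedFreeResolution

/-- `R ⧸ I` has a minimal graded free resolution with graded Betti numbers `b`, and `I` is
homogeneous (so that every such resolution has these Betti numbers). -/
def HasBetti (I : Ideal (MvPolynomial σ k)) (b : ℕ → ℕ → ℕ) : Prop :=
  IsHomogeneousIdeal I ∧ ∃ F : MinimalGradedFreeResolution I, ∀ i j, F.betti i j = b i j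

theorem HasBetti.betti_eq {I : Ideal (MvPolynomial σ k)} {b : ℕ → ℕ → ℕ} (h : HasBetti I b)
    (F : MinimalGradedFreeResolution I) (i j : ℕ) : F.betti i j = b i j := by
  obtain ⟨hI, G, hG⟩ := h
  rw [← hG, F.betti_eq hI]

theorem hasBetti_bot : HasBetti (⊥ : Ideal (MvPolynomial σ k))
    fun i j => if i = 0 ∧ j = 0 then 1 else 0 := by
  refine ⟨fun g hg j => by simp [(Ideal.mem_bot).1 hg], .ofBot, fun i j => ?_⟩
  rw [MinimalGradedFreeResolution.betti_eq_sum]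
  rcases i with _ | i
  · change ∑ a : Fin 1, (if 0 = j then 1 else 0) = _
    simp [eq_comm]
  · change ∑ a : Fin 0, (if 0 = j then 1 else 0) = _
    simp

theorem IsHomogeneousIdeal.sup_span_singleton {I : Ideal (MvPolynomial σ k)}
    (hI : IsHomogeneousIdeal I) {f : MvPolynomial σ k} {d : ℕ} (hf : f.IsHomogeneous d) :
    IsHomogeneousIdeal (I ⊔ Ideal.span {f}) := by
  intro g hg j
  obtain ⟨c, i, hi, rfl⟩ := Ideal.mem_span_singleton_sup.1 (sup_comm I _ ▸ hg)
  rw [map_add]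
  refine add_mem ?_ (Ideal.mem_sup_left (hI _ hi j))
  refine Ideal.mem_sup_right (Ideal.mem_span_singleton.2 ?_)
  clear hg
  induction c using MvPolynomial.induction_on' with
  | monomial u a =>
    rw [homogeneousComponent_of_mem ((isHomogeneous_monomial a rfl).mul hf)]
    split_ifs
    · exact dvd_mul_left _ _
    · exact dvd_zero _
  | add p q hp hq => rw [add_mul, map_add]; exact dvd_add hp hq

/-- The iterated mapping cone step. -/
theorem HasBetti.sup_span_singleton {I J : Ideal (MvPolynomial σ k)} {b c : ℕ → ℕ → ℕ}
    (hb : HasBetti I b) (hc : HasBetti J c) {f : MvPolynomial σ k} {d : ℕ} (hf : f.IsHomogeneous d)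
    (hJ : ∀ g, g ∈ J ↔ f * g ∈ I)
    (hdeg : ∀ i j j', b i j ≠ 0 → c i j' ≠ 0 → j ≠ j' + d) :
    HasBetti (I ⊔ Ideal.span {f})
      fun i j => b i j + if 1 ≤ i ∧ d ≤ j then c (i - 1) (j - d) else 0 := by
  obtain ⟨hI, F, hF⟩ := hb
  obtain ⟨-, G, hG⟩ := hc
  obtain ⟨φ, h1, h2, h3⟩ := F.exists_chainMap G hI hf fun g hg => (hJ g).1 hg
  -- Degrees of basis elements are exactly those with nonzero Betti number, so the numerical
  -- hypothesis on b and c gives minimality of the cone.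
  have pos {L : Ideal (MvPolynomial σ k)} (H : MinimalGradedFreeResolution L) (i a) :
      H.betti i (H.deg i a) ≠ 0 :=
    Finset.card_ne_zero_of_mem (a := a) (by simp)
  refine ⟨hI.sup_span_singleton hf, F.cone G f d hJ (fun i a a' => ?_) φ h1 h2 h3, fun i j => ?_⟩
  · exact hdeg i _ _ (by rw [← hF]; exact pos _ _ _) (by rw [← hG]; exact pos _ _ _)
  · rw [MinimalGradedFreeResolution.betti_eq_sum]
    cases i with
    | zero =>
      dsimp only
      rw [← hF, F.betti_eq_sum]
      rw [if_neg (by omega), add_zero]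
      rfl
    | succ i =>
      dsimp only
      rw [← hF, F.betti_eq_sum]
      change ∑ a : Fin (F.rank (i + 1) + G.rank i),
        (if Fin.append (F.deg (i + 1)) (fun a => G.deg i a + d) a = j then 1 else 0) = _
      rw [Fin.sum_univ_add]
      simp only [Fin.append_left, Fin.append_right]
      congr 1
      split_ifs with h
      · rw [Nat.add_sub_cancel, ← hG, G.betti_eq_sum]
        refine Finset.sum_congr rfl fun a _ => ?_
        congr 1
        exact propext (by omega)
      · exact Finset.sum_eq_zero fun a _ => if_neg (by omega)

end Cone

/-! ### Monomial ideals, Koszul Betti numbers and linear quotients. -/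

section MonomialIdeal

variable {k σ : Type*} [Field k]

/-- The ideal generated by the monomials with exponent in `U`. -/
noncomputable def monomialIdeal (k : Type*) {σ : Type*} [Field k] (U : Set (σ →₀ ℕ)) :
    Ideal (MvPolynomial σ k) :=
  Ideal.span ((fun s => monomial s (1 : k)) '' U)

theorem mem_monomialIdeal_iff {U : Set (σ →₀ ℕ)} (hU : IsUpperSet U) {p : MvPolynomial σ k} :
    p ∈ monomialIdeal k U ↔ ∀ w, coeff w p ≠ 0 → w ∈ U := by
  rw [monomialIdeal, mem_ideal_span_monomial_image]
  simp only [mem_support_iff]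
  exact forall₂_congr fun w _ => ⟨fun ⟨u, hu, h⟩ => hU h hu, fun h => ⟨w, h, le_rfl⟩⟩

theorem monomialIdeal_union_setOf_le (U : Set (σ →₀ ℕ)) (m : σ →₀ ℕ) :
    monomialIdeal k (U ∪ {u | m ≤ u}) = monomialIdeal k U ⊔ Ideal.span {monomial m 1} := by
  rw [monomialIdeal, Set.image_union, Ideal.span_union, monomialIdeal]
  congr 1
  refine le_antisymm (Ideal.span_le.2 ?_) (Ideal.span_le.2 ?_)
  · rintro _ ⟨u, hu, rfl⟩
    exact Ideal.mem_span_singleton.2 (monomial_dvd_monomial.2 ⟨.inr hu, dvd_rfl⟩)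
  · rintro _ rfl
    exact Ideal.subset_span ⟨m, show m ≤ m from le_rfl, rfl⟩

/-- A colon by a monomial can be computed on exponents, since multiplication by it only translates
the support. -/
theorem monomial_mul_mem_monomialIdeal_iff {U V : Set (σ →₀ ℕ)} (hU : IsUpperSet U)
    (hV : IsUpperSet V) {m : σ →₀ ℕ} (h : ∀ u, u ∈ V ↔ u + m ∈ U) (p : MvPolynomial σ k) :
    p ∈ monomialIdeal k V ↔ monomial m 1 * p ∈ monomialIdeal k U := by
  classical
  rw [mem_monomialIdeal_iff hU, mem_monomialIdeal_iff hV]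
  constructor
  · intro hp w hw
    rw [coeff_monomial_mul'] at hw
    by_cases hm : m ≤ w
    · rw [if_pos hm, one_mul] at hw
      simpa [tsub_add_cancel_of_le hm] using (h _).1 (hp _ hw)
    · simp [hm] at hw
  · intro hp w hw
    refine (h w).2 (hp _ ?_)
    rwa [add_comm, coeff_monomial_mul, one_mul]

theorem apply_mem_map_iff (τ : MvPolynomial σ k ≃ₐ[k] MvPolynomial σ k)
    {I : Ideal (MvPolynomial σ k)} {p : MvPolynomial σ k} :
    τ p ∈ I.map τ ↔ p ∈ I := by
  rw [Ideal.mem_map_of_equiv]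
  exact ⟨fun ⟨q, hq, h⟩ => τ.injective h ▸ hq, fun h => ⟨p, h, rfl⟩⟩

/-- The cone step stated on exponent sets. Carrying the coordinate change `τ` along avoids
transporting resolutions through it afterwards. -/
theorem HasBetti.insert_monomial (τ : MvPolynomial σ k ≃ₐ[k] MvPolynomial σ k)
    (hτ : ∀ g d, g.IsHomogeneous d → (τ g).IsHomogeneous d)
    {U V : Set (σ →₀ ℕ)} (hU : IsUpperSet U) (hV : IsUpperSet V)
    {b c : ℕ → ℕ → ℕ} (hb : HasBetti ((monomialIdeal k U).map τ) b)
    (hc : HasBetti ((monomialIdeal k V).map τ) c) {m : σ →₀ ℕ} {d : ℕ} (hm : m.degree = d)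
    (h : ∀ u, u ∈ V ↔ u + m ∈ U) (hdeg : ∀ i j j', b i j ≠ 0 → c i j' ≠ 0 → j ≠ j' + d) :
    HasBetti ((monomialIdeal k (U ∪ {u | m ≤ u})).map τ)
      fun i j => b i j + if 1 ≤ i ∧ d ≤ j then c (i - 1) (j - d) else 0 := by
  rw [monomialIdeal_union_setOf_le, Ideal.map_sup, Ideal.map_span, Set.image_singleton]
  refine hb.sup_span_singleton hc (hτ _ _ (isHomogeneous_monomial 1 hm)) (fun g => ?_) hdeg
  obtain ⟨g, rfl⟩ := τ.surjective g
  change _ ↔ τ _ * τ g ∈ _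
  rw [← map_mul, apply_mem_map_iff, apply_mem_map_iff]
  exact monomial_mul_mem_monomialIdeal_iff hU hV h g

theorem isUpperSet_exists_ne_zero (S : Finset σ) : IsUpperSet {u : σ →₀ ℕ | ∃ v ∈ S, u v ≠ 0} :=
  fun _ _ h ⟨v, hv, h0⟩ => ⟨v, hv, fun h' => h0 (Nat.le_zero.1 (h' ▸ h v))⟩

/-- The Betti numbers of the Koszul complex. -/
theorem hasBetti_variables (τ : MvPolynomial σ k ≃ₐ[k] MvPolynomial σ k)
    (hτ : ∀ g d, g.IsHomogeneous d → (τ g).IsHomogeneous d)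
    (S : Finset σ) :
    HasBetti ((monomialIdeal k {u | ∃ v ∈ S, u v ≠ 0}).map τ)
      fun i j => if i = j then S.card.choose i else 0 := by
  classical
  induction S using Finset.induction_on with
  | empty =>
    have h : ((monomialIdeal k {u : σ →₀ ℕ | ∃ v ∈ (∅ : Finset σ), u v ≠ 0}).map τ) = ⊥ := by
      simp [monomialIdeal]
    rw [h]
    convert hasBetti_bot using 3 with i j
    rcases i with _ | i
    · simp [eq_comm]
    · simp
  | insert t S ht ih =>
    have hU : {u : σ →₀ ℕ | ∃ v ∈ insert t S, u v ≠ 0} =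
        {u | ∃ v ∈ S, u v ≠ 0} ∪ {u | Finsupp.single t 1 ≤ u} := by
      ext u
      simp [Finsupp.single_le_iff, Nat.one_le_iff_ne_zero, or_comm]
    rw [hU]
    -- A new variable is a nonzerodivisor modulo the others, so the colon ideal is the same ideal,
    -- and Pascal's rule gives the binomials.
    convert HasBetti.insert_monomial τ hτ (isUpperSet_exists_ne_zero S)
      (isUpperSet_exists_ne_zero S) ih ih (m := Finsupp.single t 1) (d := 1) (by simp)
      (fun u => ?_) (fun i j j' h h' => ?_) using 3 with i j
    · rw [Finset.card_insert_of_notMem ht]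
      rcases i with _ | i
      · simp
      · rcases j with _ | j
        · simp
        · by_cases hij : i = j
          · simp [hij, Nat.choose_succ_succ, add_comm]
          · simp [hij]
    · refine exists_congr fun v => and_congr_right fun hv => ?_
      have : t ≠ v := fun h => ht (h ▸ hv)
      simp [this]
    · simp only [ne_eq, ite_eq_right_iff, Classical.not_imp] at h h'
      omega

/-- Adjoining the monomials `m t`, `t ∈ A`, of the same degree, to a monomial ideal, when the
successive colon ideals are generated by variables. -/
theorem HasBetti.linear_quotients (τ : MvPolynomial σ k ≃ₐ[k] MvPolynomial σ k)
    (hτ : ∀ g d, g.IsHomogeneous d → (τ g).IsHomogeneous d)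
    {α : Type*} [LinearOrder α] (A : Finset α) (m : α → σ →₀ ℕ)
    (S : α → Finset σ) (d : ℕ) (hd : ∀ t ∈ A, (m t).degree = d) {U : Set (σ →₀ ℕ)}
    (hU : IsUpperSet U) {b : ℕ → ℕ → ℕ} (hb : HasBetti ((monomialIdeal k U).map τ) b)
    (hbd : ∀ i j, b i j ≠ 0 → j < i + d)
    (h : ∀ t ∈ A, ∀ u, (∃ v ∈ S t, u v ≠ 0) ↔ (u + m t ∈ U ∨ ∃ s ∈ A, s < t ∧ m s ≤ u + m t)) :
    HasBetti ((monomialIdeal k (U ∪ {u | ∃ t ∈ A, m t ≤ u})).map τ)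
      fun i j => b i j + if 1 ≤ i ∧ j + 1 = i + d then ∑ t ∈ A, (S t).card.choose (i - 1) else 0 := by
  induction A using Finset.induction_on_max with
  | empty => simpa using hb
  | insert a A ha ih =>
    have haA : a ∉ A := fun h' => lt_irrefl _ (ha a h')
    have ih := ih (fun t ht => hd t (Finset.mem_insert_of_mem ht)) fun t ht u => by
      rw [h t (Finset.mem_insert_of_mem ht) u]
      have : ¬ a < t := not_lt.2 (ha t ht).le
      simp [this]
    have hU' : U ∪ {u | ∃ t ∈ insert a A, m t ≤ u} =
        (U ∪ {u | ∃ t ∈ A, m t ≤ u}) ∪ {u | m a ≤ u} := by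
      ext u
      simp only [Finset.mem_insert, Set.mem_union, Set.mem_ofPred_eq, exists_eq_or_imp]
      rw [or_assoc, or_comm (b := m a ≤ u)]
    rw [hU']
    have hup : IsUpperSet {u | ∃ t ∈ A, m t ≤ u} := fun _ _ h ⟨t, ht, h'⟩ => ⟨t, ht, h'.trans h⟩
    convert HasBetti.insert_monomial τ hτ (hU.union hup)
      (isUpperSet_exists_ne_zero (S a)) ih (hasBetti_variables τ hτ (S a))
      (hd a (Finset.mem_insert_self a A)) (fun u => ?_) (fun i j j' h h' => ?_) using 3 with i j
    · rw [Finset.sum_insert haA, add_assoc]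
      congr 1
      rcases i with _ | i
      · simp
      · by_cases hj : j = i + d
        · subst hj
          simp only [show i + d + 1 = i + 1 + d by omega, Nat.le_add_left, Nat.add_sub_cancel,
            and_self, if_true]
          exact add_comm _ _
        · have h1 : ¬ (j + 1 = i + 1 + d) := by omega
          have h2 : d ≤ j → ¬ (i = j - d) := by omega
          simp only [h1, and_false, if_false, zero_add]
          split_ifs with h3 h4
          · exact absurd h4 (h2 h3.2)
          · rfl
          · rfl
    · rw [Set.mem_ofPred_eq, h a (Finset.mem_insert_self a A) u]
      simp only [Finset.mem_insert, Set.mem_union, Set.mem_ofPred_eq, exists_eq_or_imp, lt_irrefl,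
        false_and, false_or]
      refine or_congr_right (exists_congr fun t => and_congr_right fun ht => ?_)
      simp [ha t ht]
    · simp only [ne_eq, ite_eq_right_iff, Classical.not_imp] at h'
      -- The Koszul part is shifted to degree i + d, while the generators already adjoined
      -- contribute only in degree i + d - 1.
      have : j < i + d := by
        by_cases hb0 : b i j = 0
        · simp only [hb0, zero_add, ne_eq, ite_eq_right_iff, Classical.not_imp] at h
          omega
        · exact hbd i j hb0
      omega

theorem HasBetti.linear_quotients_of_injective (τ : MvPolynomial σ k ≃ₐ[k] MvPolynomial σ k)
    (hτ : ∀ g d, g.IsHomogeneous d → (τ g).IsHomogeneous d)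
    {α β : Type*} [LinearOrder β] {κ : α → β} (hκ : Function.Injective κ) (A : Finset α)
    (m : α → σ →₀ ℕ) (S : α → Finset σ) (d : ℕ) (hd : ∀ t ∈ A, (m t).degree = d)
    {U : Set (σ →₀ ℕ)} (hU : IsUpperSet U) {b : ℕ → ℕ → ℕ}
    (hb : HasBetti ((monomialIdeal k U).map τ) b) (hbd : ∀ i j, b i j ≠ 0 → j < i + d)
    (h : ∀ t ∈ A, ∀ u,
      (∃ v ∈ S t, u v ≠ 0) ↔ (u + m t ∈ U ∨ ∃ s ∈ A, κ s < κ t ∧ m s ≤ u + m t)) :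
    HasBetti ((monomialIdeal k (U ∪ {u | ∃ t ∈ A, m t ≤ u})).map τ)
      fun i j => b i j + if 1 ≤ i ∧ j + 1 = i + d then ∑ t ∈ A, (S t).card.choose (i - 1) else 0 :=
  letI := LinearOrder.lift' κ hκ
  HasBetti.linear_quotients τ hτ A m S d hd hU hb hbd h

end MonomialIdeal

/-! ### Generators of the double point ideal and their colon ideals. -/

section DoublePoints

open Finsupp (single)

section Exponents

variable {σ : Type*} {a b c : σ} {w : σ →₀ ℕ}

theorem single_add_single_le_iff :
    single a 1 + single b 1 ≤ w ↔ 1 ≤ w a ∧ 1 ≤ w b ∧ (a = b → 2 ≤ w a) := by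
  classical
  constructor
  · intro h
    have ha := h a
    have hb := h b
    simp only [Finsupp.add_apply, Finsupp.single_apply] at ha hb
    grind
  · intro h l
    simp only [Finsupp.add_apply, Finsupp.single_apply]
    grind

theorem single_add_single_add_single_le_iff (hab : a ≠ b) (hac : a ≠ c) (hbc : b ≠ c) :
    single a 1 + single b 1 + single c 1 ≤ w ↔ 1 ≤ w a ∧ 1 ≤ w b ∧ 1 ≤ w c := by
  classical
  constructor
  · intro h
    have ha := h a
    have hb := h b
    have hc := h c
    simp only [Finsupp.add_apply, Finsupp.single_apply] at ha hb hc
    grind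
  · intro h l
    simp only [Finsupp.add_apply, Finsupp.single_apply]
    grind

theorem single_two_add_single_two_le_iff (hab : a ≠ b) :
    single a 2 + single b 2 ≤ w ↔ 2 ≤ w a ∧ 2 ≤ w b := by
  classical
  constructor
  · intro h
    have ha := h a
    have hb := h b
    simp only [Finsupp.add_apply, Finsupp.single_apply] at ha hb
    grind
  · intro h l
    simp only [Finsupp.add_apply, Finsupp.single_apply]
    grind

end Exponents

variable {n : ℕ} (ρ : Fin (n + 1))

/-- Pairs `(j, i)` with `ρ < i ≤ j`, indexing the generators `x_i x_j`. -/
def bigPairs : Finset (Fin (n + 1) × Fin (n + 1)) := {t | ρ < t.2 ∧ t.2 ≤ t.1}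

/-- Triples `(l, b, a)` with `a < b ≤ ρ < l`, indexing the generators `x_a x_b x_l`. -/
def mixedTriples : Finset (Fin (n + 1) × Fin (n + 1) × Fin (n + 1)) :=
  {t | ρ < t.1 ∧ t.2.1 ≤ ρ ∧ t.2.2 < t.2.1}

/-- Triples `(c, b, a)` with `a < b < c ≤ ρ`, indexing the generators `x_a x_b x_c`. -/
def smallTriples : Finset (Fin (n + 1) × Fin (n + 1) × Fin (n + 1)) :=
  {t | t.1 ≤ ρ ∧ t.2.1 < t.1 ∧ t.2.2 < t.2.1}

/-- Pairs `(b, a)` with `a < b ≤ ρ`, indexing the generators `x_a² x_b²`. -/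
def smallPairs : Finset (Fin (n + 1) × Fin (n + 1)) := {t | t.1 ≤ ρ ∧ t.2 < t.1}

/-- The exponent of `x_i x_j`. -/
noncomputable def pairExponent (t : Fin (n + 1) × Fin (n + 1)) : Fin (n + 1) →₀ ℕ :=
  single t.2 1 + single t.1 1

/-- The exponent of `x_a x_b x_c`. -/
noncomputable def tripleExponent (t : Fin (n + 1) × Fin (n + 1) × Fin (n + 1)) :
    Fin (n + 1) →₀ ℕ :=
  single t.2.2 1 + single t.2.1 1 + single t.1 1

/-- The exponent of `x_a² x_b²`. -/
noncomputable def squarePairExponent (t : Fin (n + 1) × Fin (n + 1)) : Fin (n + 1) →₀ ℕ :=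
  single t.2 2 + single t.1 2

theorem exists_mem_bigPairs_iff (w : Fin (n + 1) →₀ ℕ) :
    (∃ t ∈ bigPairs ρ, pairExponent t ≤ w) ↔
      ∃ i j, ρ < i ∧ ρ < j ∧ 1 ≤ w i ∧ 1 ≤ w j ∧ (i = j → 2 ≤ w i) := by
  simp only [bigPairs, pairExponent, single_add_single_le_iff, Finset.mem_filter_univ, Prod.exists]
  constructor
  · rintro ⟨j, i, h⟩
    exact ⟨i, j, h.1.1, by grind, h.2⟩
  · rintro ⟨i, j, hi, hj, h⟩
    rcases le_total i j with hij | hij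
    · exact ⟨j, i, by grind⟩
    · exact ⟨i, j, by grind⟩

theorem exists_mem_mixedTriples_iff (w : Fin (n + 1) →₀ ℕ) :
    (∃ t ∈ mixedTriples ρ, tripleExponent t ≤ w) ↔
      ∃ a b l, a ≤ ρ ∧ b ≤ ρ ∧ ρ < l ∧ a ≠ b ∧ 1 ≤ w a ∧ 1 ≤ w b ∧ 1 ≤ w l := by
  simp only [mixedTriples, tripleExponent, Finset.mem_filter_univ, Prod.exists]
  constructor
  · rintro ⟨l, b, a, h, hw⟩
    rw [single_add_single_add_single_le_iff (by grind) (by grind) (by grind)] at hw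
    exact ⟨a, b, l, by grind⟩
  · rintro ⟨a, b, l, h⟩
    rcases le_total a b with hab | hab
    · exact ⟨l, b, a, by grind, by
        rw [single_add_single_add_single_le_iff (by grind) (by grind) (by grind)]; grind⟩
    · exact ⟨l, a, b, by grind, by
        rw [single_add_single_add_single_le_iff (by grind) (by grind) (by grind)]; grind⟩

theorem exists_mem_smallTriples_iff (w : Fin (n + 1) →₀ ℕ) :
    (∃ t ∈ smallTriples ρ, tripleExponent t ≤ w) ↔
      ∃ a b c, a ≤ ρ ∧ b ≤ ρ ∧ c ≤ ρ ∧ a ≠ b ∧ a ≠ c ∧ b ≠ c ∧ 1 ≤ w a ∧ 1 ≤ w b ∧ 1 ≤ w c := by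
  simp only [smallTriples, tripleExponent, Finset.mem_filter_univ, Prod.exists]
  constructor
  · rintro ⟨c, b, a, h, hw⟩
    rw [single_add_single_add_single_le_iff (by grind) (by grind) (by grind)] at hw
    exact ⟨a, b, c, by grind⟩
  · rintro ⟨a, b, c, h⟩
    have key (a b c : Fin (n + 1)) (hab : a < b) (hbc : b < c) (hc : c ≤ ρ) (ha : 1 ≤ w a)
        (hb : 1 ≤ w b) (hcw : 1 ≤ w c) : ∃ c b a, (c ≤ ρ ∧ b < c ∧ a < b) ∧
          single a 1 + single b 1 + single c 1 ≤ w :=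
      ⟨c, b, a, by grind, by
        rw [single_add_single_add_single_le_iff (by grind) (by grind) (by grind)]; grind⟩
    grind

theorem exists_mem_smallPairs_iff (w : Fin (n + 1) →₀ ℕ) :
    (∃ t ∈ smallPairs ρ, squarePairExponent t ≤ w) ↔
      ∃ a b, a ≤ ρ ∧ b ≤ ρ ∧ a ≠ b ∧ 2 ≤ w a ∧ 2 ≤ w b := by
  simp only [smallPairs, squarePairExponent, Finset.mem_filter_univ, Prod.exists]
  constructor
  · rintro ⟨b, a, h, hw⟩
    rw [single_two_add_single_two_le_iff (by grind)] at hw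
    exact ⟨a, b, by grind⟩
  · rintro ⟨a, b, h⟩
    rcases le_total a b with hab | hab
    · exact ⟨b, a, by grind, by rw [single_two_add_single_two_le_iff (by grind)]; grind⟩
    · exact ⟨a, b, by grind, by rw [single_two_add_single_two_le_iff (by grind)]; grind⟩

/-- For ρ < v < j, replacing x_j by x_v in x_i x_j gives an earlier generator. Conversely, a
multiple of x_i x_j by other variables contains no earlier pair, since pairs are ordered by their
larger index first. -/
theorem bigPairs_colon {t : Fin (n + 1) × Fin (n + 1)} (ht : t ∈ bigPairs ρ)
    (u : Fin (n + 1) →₀ ℕ) :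
    (∃ v ∈ Finset.Ioo ρ t.1, u v ≠ 0) ↔ (u + pairExponent t ∈ (∅ : Set (Fin (n + 1) →₀ ℕ)) ∨
      ∃ s ∈ bigPairs ρ, toLex s < toLex t ∧ pairExponent s ≤ u + pairExponent t) := by
  obtain ⟨j, i⟩ := t
  simp only [bigPairs, pairExponent, single_add_single_le_iff, Finset.mem_filter_univ, Prod.exists,
    Prod.Lex.toLex_lt_toLex, Finset.mem_Ioo, Set.mem_empty_iff_false, false_or, Finsupp.add_apply,
    Finsupp.single_apply] at ht ⊢
  constructor
  · rintro ⟨v, hv, h0⟩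
    rcases le_total v i with h | h
    · exact ⟨i, v, by grind⟩
    · exact ⟨v, i, by grind⟩
  · rintro ⟨j', i', h⟩
    by_contra! h0
    have := h0 i'
    have := h0 j'
    grind

/-- A variable beyond ρ pairs with x_l to form a quadric already present; a variable x_v with v < b,
v ≠ a, can replace x_b and gives an earlier triple. -/
theorem mixedTriples_colon {t : Fin (n + 1) × Fin (n + 1) × Fin (n + 1)}
    (ht : t ∈ mixedTriples ρ) (u : Fin (n + 1) →₀ ℕ) :
    (∃ v ∈ Finset.Ioi ρ ∪ (Finset.Iio t.2.1).erase t.2.2, u v ≠ 0) ↔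
      ((∃ s ∈ bigPairs ρ, pairExponent s ≤ u + tripleExponent t) ∨
      ∃ s ∈ mixedTriples ρ, toLex (s.1, toLex s.2) < toLex (t.1, toLex t.2) ∧
        tripleExponent s ≤ u + tripleExponent t) := by
  rw [exists_mem_bigPairs_iff]
  obtain ⟨l, b, a⟩ := t
  simp only [mixedTriples, Finset.mem_filter_univ, Prod.exists] at ht ⊢
  have key (l' b' a' : Fin (n + 1)) (h : ρ < l' ∧ b' ≤ ρ ∧ a' < b') (w : Fin (n + 1) →₀ ℕ) :
      tripleExponent (l', b', a') ≤ w ↔ 1 ≤ w a' ∧ 1 ≤ w b' ∧ 1 ≤ w l' :=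
    single_add_single_add_single_le_iff (by grind) (by grind) (by grind)
  simp only [Prod.Lex.toLex_lt_toLex, Finset.mem_union, Finset.mem_Ioi, Finset.mem_erase,
    Finset.mem_Iio]
  constructor
  · rintro ⟨v, hv, h0⟩
    by_cases hb : ρ < v
    · refine .inl ⟨v, l, hb, ht.1, ?_⟩
      simp only [tripleExponent, Finsupp.add_apply, Finsupp.single_apply]
      grind
    · refine .inr ?_
      rcases le_total v a with h | h
      · refine ⟨l, a, v, by grind, by grind, (key _ _ _ (by grind) _).2 ?_⟩
        simp only [tripleExponent, Finsupp.add_apply, Finsupp.single_apply]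
        grind
      · refine ⟨l, v, a, by grind, by grind, (key _ _ _ (by grind) _).2 ?_⟩
        simp only [tripleExponent, Finsupp.add_apply, Finsupp.single_apply]
        grind
  · intro h
    by_contra! h0
    have hw (v : Fin (n + 1)) : (u + tripleExponent (l, b, a)) v =
        u v + ((if a = v then 1 else 0) + (if b = v then 1 else 0) + (if l = v then 1 else 0)) := by
      simp only [tripleExponent, Finsupp.add_apply, Finsupp.single_apply]
    rcases h with ⟨i, j, h⟩ | ⟨l', b', a', h1, h2, h3⟩
    · rw [hw, hw] at h
      have := h0 i
      have := h0 j
      grind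
    · rw [key _ _ _ h1, hw, hw, hw] at h3
      have := h0 l'
      have := h0 b'
      have := h0 a'
      grind

/-- A variable beyond ρ forms a mixed cubic with x_a x_b; any x_v with v < c other than x_a, x_b can
replace x_c. -/
theorem smallTriples_colon {t : Fin (n + 1) × Fin (n + 1) × Fin (n + 1)}
    (ht : t ∈ smallTriples ρ) (u : Fin (n + 1) →₀ ℕ) :
    (∃ v ∈ Finset.Ioi ρ ∪ ((Finset.Iio t.1).erase t.2.1).erase t.2.2, u v ≠ 0) ↔
      (((∃ s ∈ bigPairs ρ, pairExponent s ≤ u + tripleExponent t) ∨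
        ∃ s ∈ mixedTriples ρ, tripleExponent s ≤ u + tripleExponent t) ∨
      ∃ s ∈ smallTriples ρ, toLex (s.1, toLex s.2) < toLex (t.1, toLex t.2) ∧
        tripleExponent s ≤ u + tripleExponent t) := by
  rw [exists_mem_bigPairs_iff, exists_mem_mixedTriples_iff]
  obtain ⟨c, b, a⟩ := t
  simp only [smallTriples, Finset.mem_filter_univ, Prod.exists] at ht ⊢
  have key (c' b' a' : Fin (n + 1)) (h : c' ≤ ρ ∧ b' < c' ∧ a' < b') (w : Fin (n + 1) →₀ ℕ) :
      tripleExponent (c', b', a') ≤ w ↔ 1 ≤ w a' ∧ 1 ≤ w b' ∧ 1 ≤ w c' :=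
    single_add_single_add_single_le_iff (by grind) (by grind) (by grind)
  have hw (v : Fin (n + 1)) : (u + tripleExponent (c, b, a)) v =
      u v + ((if a = v then 1 else 0) + (if b = v then 1 else 0) + (if c = v then 1 else 0)) := by
    simp only [tripleExponent, Finsupp.add_apply, Finsupp.single_apply]
  simp only [Prod.Lex.toLex_lt_toLex, Finset.mem_union, Finset.mem_Ioi, Finset.mem_erase,
    Finset.mem_Iio]
  constructor
  · rintro ⟨v, hv, h0⟩
    by_cases hb : ρ < v
    · refine .inl (.inr ⟨a, b, v, ?_⟩)
      rw [hw, hw, hw]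
      grind
    · refine .inr ?_
      -- The three cases sort {a, b, v}; its maximum is below c, so the new triple is earlier.
      rcases lt_or_ge v a with h | h
      · refine ⟨b, a, v, by grind, by grind, (key _ _ _ (by grind) _).2 ?_⟩
        rw [hw, hw, hw]
        grind
      · rcases lt_or_ge v b with h' | h'
        · refine ⟨b, v, a, by grind, by grind, (key _ _ _ (by grind) _).2 ?_⟩
          rw [hw, hw, hw]
          grind
        · refine ⟨v, b, a, by grind, by grind, (key _ _ _ (by grind) _).2 ?_⟩
          rw [hw, hw, hw]
          grind
  · intro h
    by_contra! h0
    rcases h with (⟨i, j, h⟩ | ⟨i, j, l, h⟩) | ⟨c', b', a', h1, h2, h3⟩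
    · rw [hw, hw] at h
      have := h0 i
      grind
    · rw [hw, hw, hw] at h
      have := h0 l
      grind
    · rw [key _ _ _ h1, hw, hw, hw] at h3
      have := h0 c'
      have := h0 b'
      have := h0 a'
      grind

/-- Every other variable x_v works, since x_a x_b x_v is already present; a monomial in x_a and x_b
alone is divisible by no earlier generator. -/
theorem smallPairs_colon {t : Fin (n + 1) × Fin (n + 1)}
    (ht : t ∈ smallPairs ρ) (u : Fin (n + 1) →₀ ℕ) :
    (∃ v ∈ (Finset.univ.erase t.1).erase t.2, u v ≠ 0) ↔
      ((((∃ s ∈ bigPairs ρ, pairExponent s ≤ u + squarePairExponent t) ∨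
        ∃ s ∈ mixedTriples ρ, tripleExponent s ≤ u + squarePairExponent t) ∨
        ∃ s ∈ smallTriples ρ, tripleExponent s ≤ u + squarePairExponent t) ∨
      ∃ s ∈ smallPairs ρ, toLex s < toLex t ∧ squarePairExponent s ≤ u + squarePairExponent t) := by
  rw [exists_mem_bigPairs_iff, exists_mem_mixedTriples_iff, exists_mem_smallTriples_iff]
  obtain ⟨b, a⟩ := t
  simp only [smallPairs, Finset.mem_filter_univ, Prod.exists] at ht ⊢
  have key (b' a' : Fin (n + 1)) (h : b' ≤ ρ ∧ a' < b') (w : Fin (n + 1) →₀ ℕ) :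
      squarePairExponent (b', a') ≤ w ↔ 2 ≤ w a' ∧ 2 ≤ w b' :=
    single_two_add_single_two_le_iff (by grind)
  have hw (v : Fin (n + 1)) : (u + squarePairExponent (b, a)) v =
      u v + ((if a = v then 2 else 0) + (if b = v then 2 else 0)) := by
    simp only [squarePairExponent, Finsupp.add_apply, Finsupp.single_apply]
  simp only [Prod.Lex.toLex_lt_toLex, Finset.mem_erase, Finset.mem_univ, and_true]
  constructor
  · rintro ⟨v, hv, h0⟩
    refine .inl ?_
    by_cases hb : ρ < v
    · refine .inl (.inr ⟨a, b, v, ?_⟩)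
      rw [hw, hw, hw]
      grind
    · refine .inr ⟨a, b, v, ?_⟩
      rw [hw, hw, hw]
      grind
  · intro h
    by_contra! h0
    rcases h with ((⟨i, j, h⟩ | ⟨i, j, l, h⟩) | ⟨i, j, l, h⟩) | ⟨b', a', h1, h2, h3⟩
    · rw [hw, hw] at h
      have := h0 i
      grind
    · rw [hw, hw, hw] at h
      have := h0 l
      grind
    · rw [hw, hw, hw] at h
      have := h0 i
      have := h0 j
      have := h0 l
      grind
    · rw [key _ _ h1, hw, hw] at h3
      have := h0 b'
      have := h0 a'
      grind

/-- The exponents of the monomials which vanish doubly at the coordinate points `P_i`, `i ≤ ρ`. -/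
def doublePointExponents : Set (Fin (n + 1) →₀ ℕ) :=
  {w | ∀ i ≤ ρ, ∃ a b, a ≠ i ∧ b ≠ i ∧ single a 1 + single b 1 ≤ w}

/-- Sort by the degree in the variables beyond ρ. Degree at least 2 gives a quadric; degree 1 forces
two distinct variables up to ρ; degree 0 leaves either three distinct variables or two whose
exponents are both at least 2. -/
theorem doublePointExponents_eq : doublePointExponents ρ =
    ((∅ ∪ {w | ∃ t ∈ bigPairs ρ, pairExponent t ≤ w}) ∪
      {w | ∃ t ∈ mixedTriples ρ, tripleExponent t ≤ w} ∪
      {w | ∃ t ∈ smallTriples ρ, tripleExponent t ≤ w}) ∪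
      {w | ∃ t ∈ smallPairs ρ, squarePairExponent t ≤ w} := by
  ext w
  simp only [doublePointExponents, Set.mem_union, Set.mem_ofPred_eq, Set.mem_empty_iff_false,
    false_or, exists_mem_bigPairs_iff, exists_mem_mixedTriples_iff, exists_mem_smallTriples_iff,
    exists_mem_smallPairs_iff, single_add_single_le_iff]
  constructor
  · intro h
    by_contra! h0
    obtain ⟨⟨⟨h1, h2⟩, h3⟩, h4⟩ := h0
    obtain ⟨a₀, b₀, h0⟩ := h ρ le_rfl
    by_cases hbig : ∃ l, ρ < l ∧ 1 ≤ w l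
    · obtain ⟨l, hl, hwl⟩ := hbig
      have aux (i : Fin (n + 1)) (hi : i ≤ ρ) : ∃ a, a ≠ i ∧ a ≤ ρ ∧ 1 ≤ w a := by
        obtain ⟨a, b, h⟩ := h i hi
        by_contra! hs
        have := hs a
        have := hs b
        have := h1 a b
        grind
      obtain ⟨a, ha⟩ := aux ρ le_rfl
      obtain ⟨b, hb⟩ := aux a ha.2.1
      have := h2 a b l
      grind
    · push Not at hbig
      -- The two factors off i must coincide, as otherwise they form with i three distinct
      -- variables. Applying this twice produces the two squares.
      have aux (i : Fin (n + 1)) (hi : i ≤ ρ) (hwi : 1 ≤ w i) :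
          ∃ a, a ≠ i ∧ a ≤ ρ ∧ 2 ≤ w a := by
        obtain ⟨a, b, h⟩ := h i hi
        have := hbig a
        have := hbig b
        have := h3 i a b
        exact ⟨a, by grind⟩
      have := hbig a₀
      obtain ⟨a, ha⟩ := aux a₀ (by grind) h0.2.2.1
      obtain ⟨b, hb⟩ := aux a ha.2.1 (by omega)
      have := h4 a b
      grind
  · rintro (((⟨a, b, h⟩ | ⟨a, b, c, h⟩) | ⟨a, b, c, h⟩) | ⟨a, b, h⟩) i hi
    · exact ⟨a, b, by grind⟩
    · by_cases hia : i = a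
      · exact ⟨b, c, by grind⟩
      · exact ⟨a, c, by grind⟩
    · by_cases hia : i = a
      · exact ⟨b, c, by grind⟩
      · by_cases hib : i = b
        · exact ⟨a, c, by grind⟩
        · exact ⟨a, b, by grind⟩
    · by_cases hia : i = a
      · exact ⟨b, b, by grind⟩
      · exact ⟨a, a, by grind⟩

end DoublePoints

/-! ### Summing the binomials over the generators. -/

section Count

variable {n : ℕ} (ρ : Fin (n + 1))

/-- Absorption, (t+1) C(t, q) = (q+1) C(t+1, q+1), followed by the hockey stick identity. -/
theorem sum_range_succ_mul_choose (N q : ℕ) :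
    ∑ t ∈ Finset.range N, (t + 1) * t.choose q = (N + 1).choose (q + 2) * (q + 1) := by
  induction N with
  | zero => simp [Nat.choose_eq_zero_of_lt]
  | succ N ih =>
    rw [Finset.sum_range_succ, ih, Nat.add_one_mul_choose_eq N q, Nat.choose_succ_succ (N + 1) (q + 1)]
    ring

theorem sum_bigPairs (q : ℕ) :
    ∑ t ∈ bigPairs ρ, (Finset.Ioo ρ t.1).card.choose q =
      (n - ρ + 1).choose (q + 2) * (q + 1) := by
  rw [Finset.sum_finset_product' (bigPairs ρ) (Finset.Ioi ρ) (fun j => Finset.Ioc ρ j)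
    (f := fun j _ => (Finset.Ioo ρ j).card.choose q) (by simp [bigPairs]; grind)]
  simp only [Finset.sum_const, Fin.card_Ioo, Fin.card_Ioc, smul_eq_mul]
  have := Finset.sum_map (Finset.Ioi ρ) Fin.valEmbedding fun j => (j - ρ) * (j - ρ - 1).choose q
  simp only [Fin.valEmbedding_apply] at this
  rw [← this, Fin.map_valEmbedding_Ioi, ← sum_range_succ_mul_choose]
  symm
  -- The substitution is t = j - ρ - 1, the number of variables in the colon ideal; there are t + 1
  -- choices of i for this j.
  refine Finset.sum_bij (fun (t : ℕ) _ => t + ρ + 1) ?_ ?_ ?_ ?_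
  · simp; omega
  · simp
  · intro b hb
    refine ⟨b - ρ - 1, ?_⟩
    simp at hb ⊢; omega
  · intro t ht
    congr 1
    · omega
    · congr 1; omega

theorem sum_Iic_eq_sum_range (f : ℕ → ℕ) :
    ∑ b ∈ Finset.Iic ρ, f b = ∑ b ∈ Finset.range (ρ + 1), f b := by
  have := Finset.sum_map (Finset.Iic ρ) Fin.valEmbedding f
  simp only [Fin.valEmbedding_apply] at this
  rw [← this, Fin.map_valEmbedding_Iic]
  congr 1
  ext; simp

theorem sum_Iio_eq_sum_range (f : ℕ → ℕ) :
    ∑ b ∈ Finset.Iio ρ, f b = ∑ b ∈ Finset.range ρ, f b := by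
  have := Finset.sum_map (Finset.Iio ρ) Fin.valEmbedding f
  simp only [Fin.valEmbedding_apply] at this
  rw [← this, Fin.map_valEmbedding_Iio]
  congr 1
  ext; simp

theorem card_Ioi_union_erase {a b : Fin (n + 1)} (hb : b ≤ ρ) (hab : a < b) :
    (Finset.Ioi ρ ∪ (Finset.Iio b).erase a).card = n - ρ + b - 1 := by
  rw [Finset.card_union_of_disjoint, Finset.card_erase_of_mem (by simpa), Fin.card_Ioi,
    Fin.card_Iio]
  · have : (a : ℕ) < b := hab
    omega
  · rw [Finset.disjoint_left]
    simp
    grind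

theorem card_Ioi_union_erase_erase {a b c : Fin (n + 1)} (hc : c ≤ ρ) (hbc : b < c)
    (hab : a < b) :
    (Finset.Ioi ρ ∪ ((Finset.Iio c).erase b).erase a).card = n - ρ + c - 2 := by
  rw [Finset.card_union_of_disjoint, Finset.card_erase_of_mem (by simp; grind),
    Finset.card_erase_of_mem (by simpa), Fin.card_Ioi, Fin.card_Iio]
  · have : (a : ℕ) < b := hab
    have : (b : ℕ) < c := hbc
    omega
  · rw [Finset.disjoint_left]
    simp
    grind

theorem sum_mixedTriples (q : ℕ) :
    ∑ t ∈ mixedTriples ρ, (Finset.Ioi ρ ∪ (Finset.Iio t.2.1).erase t.2.2).card.choose q =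
      (n - ρ) * ∑ i ∈ Finset.range ρ, (ρ - i) * (n - i - 1).choose q := by
  have h1 : ∑ t ∈ mixedTriples ρ, (Finset.Ioi ρ ∪ (Finset.Iio t.2.1).erase t.2.2).card.choose q =
      ∑ t ∈ mixedTriples ρ, (n - ρ + t.2.1 - 1).choose q := by
    refine Finset.sum_congr rfl fun t ht => ?_
    simp only [mixedTriples, Finset.mem_filter_univ] at ht
    rw [card_Ioi_union_erase ρ ht.2.1 ht.2.2]
  have h2 : mixedTriples ρ = Finset.Ioi ρ ×ˢ smallPairs ρ := by
    ext; simp [mixedTriples, smallPairs]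
  rw [h1, h2, Finset.sum_product]
  simp only [Finset.sum_const, Fin.card_Ioi, smul_eq_mul]
  congr 1
  rw [Finset.sum_finset_product' (smallPairs ρ) (Finset.Iic ρ) (fun j => Finset.Iio j)
    (f := fun j _ => (n - ρ + j - 1).choose q) (by simp [smallPairs])]
  simp only [Finset.sum_const, Fin.card_Iio, smul_eq_mul]
  -- The summation index is i = ρ - b, and the vanishing term b = 0 is dropped.
  rw [sum_Iic_eq_sum_range ρ fun b => b * (n - ρ + b - 1).choose q, Finset.sum_range_succ',
    zero_mul, add_zero, ← Finset.sum_range_reflect]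
  refine Finset.sum_congr rfl fun i hi => ?_
  rw [Finset.mem_range] at hi
  have := ρ.2
  congr 1
  · omega
  · congr 1; omega

theorem sum_smallTriples (q : ℕ) :
    ∑ t ∈ smallTriples ρ,
        (Finset.Ioi ρ ∪ ((Finset.Iio t.1).erase t.2.1).erase t.2.2).card.choose q =
      ∑ i ∈ Finset.range (ρ - 1), ((ρ : ℕ) - i).choose 2 * (n - i - 2).choose q := by
  have h1 : ∑ t ∈ smallTriples ρ,
      (Finset.Ioi ρ ∪ ((Finset.Iio t.1).erase t.2.1).erase t.2.2).card.choose q =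
      ∑ t ∈ smallTriples ρ, (n - ρ + t.1 - 2).choose q := by
    refine Finset.sum_congr rfl fun t ht => ?_
    simp only [smallTriples, Finset.mem_filter_univ] at ht
    rw [card_Ioi_union_erase_erase ρ ht.1 ht.2.1 ht.2.2]
  have h2 (c : Fin (n + 1)) :
      ((Finset.Iio c).sigma fun b => Finset.Iio b).card = (c : ℕ).choose 2 := by
    rw [Finset.card_sigma]
    simp only [Fin.card_Iio]
    rw [sum_Iio_eq_sum_range c fun b => b, Finset.sum_range_id, Nat.choose_two_right]
  rw [h1, Finset.sum_finset_product' (smallTriples ρ) (Finset.Iic ρ)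
    (fun c => Finset.univ.filter fun p => p.1 < c ∧ p.2 < p.1)
    (f := fun c _ => (n - ρ + c - 2).choose q) (by simp [smallTriples])]
  have h3 (c : Fin (n + 1)) : (Finset.univ.filter fun p : Fin (n + 1) × Fin (n + 1) =>
      p.1 < c ∧ p.2 < p.1).card = (c : ℕ).choose 2 := by
    rw [← h2]
    exact Finset.card_bij' (fun p _ => ⟨p.1, p.2⟩) (fun p _ => (p.1, p.2)) (by simp) (by simp)
      (by simp) (by simp)
  simp only [Finset.sum_const, h3, smul_eq_mul]
  rw [sum_Iic_eq_sum_range ρ fun c => c.choose 2 * (n - ρ + c - 2).choose q,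
    Finset.sum_range_succ', Nat.choose_zero_succ, zero_mul, add_zero]
  have hρ := ρ.2
  -- With i = ρ - c, the terms c = 0 and c = 1 vanish, which gives the range ρ - 1; truncated
  -- subtraction makes ρ = 0 a separate case.
  rcases Nat.eq_zero_or_pos (ρ : ℕ) with h | h
  · simp [h]
  · obtain ⟨s, hs⟩ := Nat.exists_eq_add_of_lt h
    rw [hs, zero_add, Finset.sum_range_succ', Nat.add_sub_cancel, ← Finset.sum_range_reflect]
    simp only [zero_add, show Nat.choose 1 2 = 0 from rfl, zero_mul, add_zero]
    refine Finset.sum_congr rfl fun i hi => ?_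
    rw [Finset.mem_range] at hi
    congr 2 <;> omega

theorem sum_smallPairs (q : ℕ) :
    ∑ t ∈ smallPairs ρ, ((Finset.univ.erase t.1).erase t.2).card.choose q =
      ((ρ : ℕ) + 1).choose 2 * (n - 1).choose q := by
  have h1 : ∑ t ∈ smallPairs ρ, ((Finset.univ.erase t.1).erase t.2).card.choose q =
      ∑ t ∈ smallPairs ρ, (n - 1).choose q := by
    refine Finset.sum_congr rfl fun t ht => ?_
    simp only [smallPairs, Finset.mem_filter_univ] at ht
    rw [Finset.card_erase_of_mem (by simp [ht.2.ne]), Finset.card_erase_of_mem (by simp),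
      Finset.card_univ, Fintype.card_fin, Nat.add_sub_cancel]
  rw [h1, Finset.sum_finset_product' (smallPairs ρ) (Finset.Iic ρ) (fun j => Finset.Iio j)
    (f := fun _ _ => (n - 1).choose q) (by simp [smallPairs])]
  simp only [Finset.sum_const, Fin.card_Iio, smul_eq_mul]
  rw [← Finset.sum_mul, sum_Iic_eq_sum_range ρ fun b => b, Finset.sum_range_id,
    Nat.choose_two_right]

theorem degree_pairExponent (t : Fin (n + 1) × Fin (n + 1)) : (pairExponent t).degree = 2 := by
  simp [pairExponent]

theorem degree_tripleExponent (t : Fin (n + 1) × Fin (n + 1) × Fin (n + 1)) :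
    (tripleExponent t).degree = 3 := by
  simp [tripleExponent]

theorem degree_squarePairExponent (t : Fin (n + 1) × Fin (n + 1)) :
    (squarePairExponent t).degree = 4 := by
  simp [squarePairExponent]

theorem isUpperSet_exists_mem_le {σ α : Type*} (A : Finset α) (m : α → σ →₀ ℕ) :
    IsUpperSet {u | ∃ t ∈ A, m t ≤ u} := fun _ _ h ⟨t, ht, h'⟩ => ⟨t, ht, h'.trans h⟩

/-- The graded Betti numbers of the ideal of the double points `P_i`, `i ≤ ρ`, in the coordinate
system given by `τ`. -/
theorem hasBetti_doublePointExponents {k : Type*} [Field k]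
    (τ : MvPolynomial (Fin (n + 1)) k ≃ₐ[k] MvPolynomial (Fin (n + 1)) k)
    (hτ : ∀ g d, g.IsHomogeneous d → (τ g).IsHomogeneous d) :
    HasBetti ((monomialIdeal k (doublePointExponents ρ)).map τ) fun i j =>
      ((((if i = 0 ∧ j = 0 then 1 else 0) +
        if 1 ≤ i ∧ j + 1 = i + 2 then (n - ρ + 1).choose (i - 1 + 2) * (i - 1 + 1) else 0) +
        if 1 ≤ i ∧ j + 1 = i + 3 then
          (n - ρ) * ∑ l ∈ Finset.range ρ, (ρ - l) * (n - l - 1).choose (i - 1) else 0) +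
        if 1 ≤ i ∧ j + 1 = i + 3 then
          ∑ l ∈ Finset.range (ρ - 1), ((ρ : ℕ) - l).choose 2 * (n - l - 2).choose (i - 1) else 0) +
        if 1 ≤ i ∧ j + 1 = i + 4 then ((ρ : ℕ) + 1).choose 2 * (n - 1).choose (i - 1) else 0 := by
  have inj : Function.Injective
      fun t : Fin (n + 1) × Fin (n + 1) × Fin (n + 1) => toLex (t.1, toLex t.2) := by
    rintro ⟨a, b⟩ ⟨a', b'⟩ h
    simpa using h
  have h0 : HasBetti ((monomialIdeal k (∅ : Set (Fin (n + 1) →₀ ℕ))).map τ)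
      fun i j => if i = 0 ∧ j = 0 then 1 else 0 := by
    simpa [monomialIdeal] using hasBetti_bot
  have h1 := HasBetti.linear_quotients_of_injective τ hτ toLex.injective (bigPairs ρ)
    pairExponent (fun t => Finset.Ioo ρ t.1) 2 (fun t _ => degree_pairExponent t) isUpperSet_empty h0
    (fun i j => by split_ifs <;> omega) (fun t ht u => bigPairs_colon ρ ht u)
  have u1 := isUpperSet_empty.union (isUpperSet_exists_mem_le (bigPairs ρ) pairExponent)
  have h2 := HasBetti.linear_quotients_of_injective τ hτ inj (mixedTriples ρ)
    tripleExponent (fun t => Finset.Ioi ρ ∪ (Finset.Iio t.2.1).erase t.2.2) 3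
    (fun t _ => degree_tripleExponent t) u1 h1
    (fun i j => by split_ifs <;> omega)
    (fun t ht u => by simpa using mixedTriples_colon ρ ht u)
  have u2 := u1.union (isUpperSet_exists_mem_le (mixedTriples ρ) tripleExponent)
  have h3 := HasBetti.linear_quotients_of_injective τ hτ inj (smallTriples ρ)
    tripleExponent (fun t => Finset.Ioi ρ ∪ ((Finset.Iio t.1).erase t.2.1).erase t.2.2) 3
    (fun t _ => degree_tripleExponent t) u2 h2
    (fun i j => by split_ifs <;> omega)
    (fun t ht u => by simpa using smallTriples_colon ρ ht u)
  have u3 := u2.union (isUpperSet_exists_mem_le (smallTriples ρ) tripleExponent)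
  have h4 := HasBetti.linear_quotients_of_injective τ hτ toLex.injective (smallPairs ρ)
    squarePairExponent (fun t => (Finset.univ.erase t.1).erase t.2) 4
    (fun t _ => degree_squarePairExponent t) u3 h3
    (fun i j => by split_ifs <;> omega)
    (fun t ht u => by simpa using smallPairs_colon ρ ht u)
  rw [← doublePointExponents_eq] at h4
  simpa only [sum_bigPairs, sum_mixedTriples, sum_smallTriples, sum_smallPairs] using h4

end Count

/-! ### Reduction to coordinate points. -/

section Coordinates

variable {k : Type*} [Field k]

theorem exists_basis_extending {n r : ℕ} (hr : r + 1 ≤ n + 1) {v : Fin (r + 1) → Fin (n + 1) → k}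
    (hv : LinearIndependent k v) :
    ∃ B : Module.Basis (Fin (n + 1)) k (Fin (n + 1) → k), ∀ i, B (Fin.castLE hr i) = v i := by
  classical
  let B := Module.Basis.sumExtend hv
  have : Finite (Fin (r + 1) ⊕ Module.Basis.sumExtendIndex hv) := Module.Finite.finite_basis B
  have : Finite (Module.Basis.sumExtendIndex hv) :=
    Finite.of_injective (Sum.inr : _ → Fin (r + 1) ⊕ _) Sum.inr_injective
  have := Fintype.ofFinite (Module.Basis.sumExtendIndex hv)
  have hcard := Module.finrank_eq_card_basis B
  rw [Module.finrank_fin_fun, Fintype.card_sum, Fintype.card_fin] at hcard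
  -- The extended basis is numbered so that the given vectors come first.
  let e := ((Equiv.refl (Fin (r + 1))).sumCongr
    (Fintype.equivFinOfCardEq (α := Module.Basis.sumExtendIndex hv) rfl)).trans
    (finSumFinEquiv.trans (finCongr hcard.symm))
  refine ⟨B.reindex e, fun i => ?_⟩
  have : e.symm (Fin.castLE hr i) = Sum.inl i := by
    rw [Equiv.symm_apply_eq]
    ext
    simp [e]
  rw [Module.Basis.reindex_apply, this]
  simp only [B, Module.Basis.sumExtend, Module.Basis.reindex_apply, Module.Basis.extend_apply_self]
  rfl

/-- A basis of `k ^ (n + 1)` gives linear coordinates on `k[x₀, …, xₙ]`. -/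
theorem exists_coordinates {n : ℕ} (B : Module.Basis (Fin (n + 1)) k (Fin (n + 1) → k)) :
    ∃ τ : MvPolynomial (Fin (n + 1)) k ≃ₐ[k] MvPolynomial (Fin (n + 1)) k,
      (∀ g d, g.IsHomogeneous d → (τ g).IsHomogeneous d) ∧
      (∀ g d, g.IsHomogeneous d → (τ.symm g).IsHomogeneous d) ∧
      ∀ i g, eval (B i) (τ g) = eval (Pi.single i 1) g := by
  let E := Pi.basisFun k (Fin (n + 1))
  have h (M N : Matrix (Fin (n + 1)) (Fin (n + 1)) k) (h : M * N = 1) :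
      (bind₁ N.toMvPolynomial).comp (bind₁ M.toMvPolynomial) = AlgHom.id k _ := by
    ext i : 1
    rw [AlgHom.comp_apply, bind₁_X_right, ← Matrix.toMvPolynomial_mul, h, Matrix.toMvPolynomial_one,
      AlgHom.id_apply]
  have hom (M : Matrix (Fin (n + 1)) (Fin (n + 1)) k) (g d) (hg : g.IsHomogeneous d) :
      (bind₁ M.toMvPolynomial g).IsHomogeneous d := by
    simpa using hg.aeval _ M.toMvPolynomial_isHomogeneous
  refine ⟨AlgEquiv.ofAlgHom (bind₁ (B.toMatrix E).toMvPolynomial)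
    (bind₁ (E.toMatrix B).toMvPolynomial) (h _ _ (E.toMatrix_mul_toMatrix_flip B))
    (h _ _ (B.toMatrix_mul_toMatrix_flip E)), hom _, hom _, fun i g => ?_⟩
  change eval (B i) (bind₁ _ g) = _
  have : (aeval (B i)).comp (bind₁ (B.toMatrix E).toMvPolynomial) =
      aeval (R := k) (S₁ := k) (Pi.single i 1) := by
    ext j : 1
    rw [AlgHom.comp_apply, bind₁_X_right, aeval_X]
    change eval (B i) _ = _
    rw [Matrix.toMvPolynomial_eval_eq_apply]
    -- The substitution uses the matrix taking standard coordinates to B-coordinates, so B i is sent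
    -- to the i-th unit vector.
    have h1 : (B.toMatrix E).mulVec (E.repr (B i)) = B.repr (B i) := E.toMatrix_mulVec_repr B (B i)
    have h2 : ⇑(E.repr (B i)) = B i := by ext; simp [E]
    rw [← h2, h1, Module.Basis.repr_self, Finsupp.single_eq_pi_single]
  exact DFunLike.congr_fun this g

/-- Among monomials of degree d only x_i^d survives at the i-th coordinate point, so its coefficient
is the value there; if that is zero, every monomial involves another variable. -/
theorem mem_span_X_of_eval_eq_zero {σ : Type*} [Fintype σ] [DecidableEq σ] {i : σ}
    {g : MvPolynomial σ k} {d : ℕ} (hg : g.IsHomogeneous d) (h : eval (Pi.single i 1) g = 0) :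
    g ∈ Ideal.span (X '' {i}ᶜ) := by
  rw [mem_ideal_span_X_image]
  by_contra! h0
  obtain ⟨w, hw, hwi⟩ := h0
  have single_eq (u : σ →₀ ℕ) (hu : u ∈ g.support) (hui : ∀ j ∈ ({i}ᶜ : Set σ), u j = 0) :
      u = Finsupp.single i d := by
    have h1 : u = Finsupp.single i (u i) := by
      ext j
      by_cases hj : j = i
      · subst hj; simp
      · rw [hui j hj, Finsupp.single_eq_of_ne hj]
    have h2 : u.degree = d := by
      by_contra h3
      exact mem_support_iff.1 hu (hg.coeff_eq_zero h3)
    rw [h1, Finsupp.degree_single] at h2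
    rw [h1, h2]
  rw [eval_eq', Finset.sum_eq_single w] at h
  · refine mem_support_iff.1 hw ?_
    rwa [Finset.prod_eq_one, mul_one] at h
    intro j _
    by_cases hj : j = i
    · subst hj; simp
    · rw [hwi j hj, pow_zero]
  · intro u hu huw
    obtain ⟨j, hj, hju⟩ : ∃ j ∈ ({i}ᶜ : Set σ), u j ≠ 0 := by
      by_contra! h1
      exact huw ((single_eq u hu h1).trans (single_eq w hw hwi).symm)
    rw [Finset.prod_eq_zero (Finset.mem_univ j), mul_zero]
    rw [Pi.single_eq_of_ne hj, zero_pow hju]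
  · exact fun h' => absurd hw h'

theorem pointIdeal_eq_map {n : ℕ} (P : ℙ k (Fin (n + 1) → k)) (i : Fin (n + 1))
    (τ : MvPolynomial (Fin (n + 1)) k ≃ₐ[k] MvPolynomial (Fin (n + 1)) k)
    (hτ : ∀ g d, g.IsHomogeneous d → (τ g).IsHomogeneous d)
    (hτ' : ∀ g d, g.IsHomogeneous d → (τ.symm g).IsHomogeneous d)
    (h : ∀ g, eval P.rep (τ g) = eval (Pi.single i 1) g) :
    pointIdeal P = (Ideal.span (X '' {i}ᶜ)).map τ := by
  refine le_antisymm (Ideal.span_le.2 ?_) ?_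
  · rintro f ⟨⟨d, hf⟩, h0⟩
    rw [← τ.apply_symm_apply f, h] at h0
    rw [← τ.apply_symm_apply f]
    exact (apply_mem_map_iff τ).2 (mem_span_X_of_eval_eq_zero (hτ' _ _ hf) h0)
  · rw [Ideal.map_span, Ideal.span_le]
    rintro _ ⟨_, ⟨j, hj, rfl⟩, rfl⟩
    refine Ideal.subset_span ⟨⟨1, hτ _ _ (isHomogeneous_X k j)⟩, ?_⟩
    rw [h, eval_X, Pi.single_eq_of_ne hj]

theorem span_X_sq_eq_monomialIdeal {σ : Type*} (i : σ) :
    Ideal.span (X '' {i}ᶜ : Set (MvPolynomial σ k)) ^ 2 = monomialIdeal k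
      {w | ∃ a b, a ≠ i ∧ b ≠ i ∧ Finsupp.single a 1 + Finsupp.single b 1 ≤ w} := by
  have hX (a b : σ) : (X a * X b : MvPolynomial σ k) =
      monomial (Finsupp.single a 1 + Finsupp.single b 1) 1 := by
    rw [X, X, monomial_mul, one_mul]
  rw [pow_two, Ideal.span_mul_span', monomialIdeal]
  refine le_antisymm (Ideal.span_le.2 ?_) (Ideal.span_le.2 ?_)
  · rintro _ ⟨_, ⟨a, ha, rfl⟩, _, ⟨b, hb, rfl⟩, rfl⟩
    exact Ideal.subset_span ⟨_, ⟨a, b, ha, hb, le_rfl⟩, (hX a b).symm⟩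
  · rintro _ ⟨w, ⟨a, b, ha, hb, hw⟩, rfl⟩
    refine Ideal.mem_of_dvd _ ?_ (Ideal.subset_span ⟨X a, ⟨a, ha, rfl⟩, X b, ⟨b, hb, rfl⟩, rfl⟩)
    change X a * X b ∣ _
    rw [hX]
    exact monomial_dvd_monomial.2 ⟨.inr hw, dvd_rfl⟩

/-- Intersecting monomial ideals amounts to intersecting their exponent sets, and the coordinate
change respects powers and intersections. -/
theorem fatPointsIdeal_two_eq_map {n r : ℕ} (hr : r + 1 ≤ n + 1)
    (P : Fin (r + 1) → ℙ k (Fin (n + 1) → k))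
    (τ : MvPolynomial (Fin (n + 1)) k ≃ₐ[k] MvPolynomial (Fin (n + 1)) k)
    (h : ∀ i, pointIdeal (P i) = (Ideal.span (X '' {Fin.castLE hr i}ᶜ)).map τ) :
    fatPointsIdeal P (fun _ => 2) =
      (monomialIdeal k (doublePointExponents (⟨r, hr⟩ : Fin (n + 1)))).map τ := by
  ext f
  obtain ⟨g, rfl⟩ := τ.surjective f
  have hup (i : Fin (n + 1)) : IsUpperSet {w : Fin (n + 1) →₀ ℕ | ∃ a b, a ≠ i ∧ b ≠ i ∧
      Finsupp.single a 1 + Finsupp.single b 1 ≤ w} :=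
    fun _ _ h ⟨a, b, ha, hb, h'⟩ => ⟨a, b, ha, hb, h'.trans h⟩
  have hup' : IsUpperSet (doublePointExponents (⟨r, hr⟩ : Fin (n + 1))) :=
    fun _ _ h h' i hi => hup i h (h' i hi)
  rw [apply_mem_map_iff, mem_monomialIdeal_iff hup']
  simp only [fatPointsIdeal, h, ← Ideal.map_pow, Ideal.mem_iInf, apply_mem_map_iff,
    span_X_sq_eq_monomialIdeal, mem_monomialIdeal_iff (hup _)]
  constructor
  · intro hg w hw i hi
    exact hg ⟨i, Nat.lt_succ_of_le hi⟩ w hw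
  · intro hg i w hw
    exact hg w hw _ (Nat.le_of_lt_succ i.2)

end Coordinates

/-! ### The theorem. -/

theorem proposition3p2 {k : Type*} [Field k] (n r : ℕ) (hr : r + 1 ≤ n + 1)
    (P : Fin (r + 1) → ℙ k (Fin (n + 1) → k)) (hP : Projectivization.Independent P) :
    Nonempty (MinimalGradedFreeResolution (fatPointsIdeal P fun _ => 2)) ∧
    ∀ F : MinimalGradedFreeResolution (fatPointsIdeal P fun _ => 2),
      (∀ q : ℕ, 1 ≤ q →
        F.betti q (q + 1) = (n - r + 1).choose (q + 1) * q.choose (q - 1) ∧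
        F.betti q (q + 2) =
          (n - r) * ∑ i ∈ Finset.range r, (r - i) * (n - i - 1).choose (q - 1) +
            ∑ i ∈ Finset.range (r - 1), (r - i).choose 2 * (n - i - 2).choose (q - 1) ∧
        F.betti q (q + 3) = (r + 1).choose 2 * (n - 1).choose (q - 1)) ∧
      F.betti 0 0 = 1 ∧
      ∀ i j : ℕ, ¬ (i = 0 ∧ j = 0) →
        ¬ (1 ≤ i ∧ (j = i + 1 ∨ j = i + 2 ∨ j = i + 3)) → F.betti i j = 0 := by
  obtain ⟨B, hB⟩ := exists_basis_extending hr (Projectivization.independent_iff.1 hP)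
  obtain ⟨τ, hτ, hτ', hev⟩ := exists_coordinates B
  have hI := fatPointsIdeal_two_eq_map hr P τ fun i =>
    pointIdeal_eq_map (P i) (Fin.castLE hr i) τ hτ hτ' fun g => by
      rw [← hev, hB, Function.comp_apply]
  have key := hasBetti_doublePointExponents (⟨r, hr⟩ : Fin (n + 1)) τ hτ
  rw [← hI] at key
  refine ⟨⟨key.2.choose⟩, fun F => ⟨fun q hq => ?_, ?_, fun i j h0 h1 => ?_⟩⟩
  · obtain ⟨q, rfl⟩ := Nat.exists_eq_add_of_le' hq
    rw [key.betti_eq, key.betti_eq, key.betti_eq]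
    refine ⟨?_, ?_, ?_⟩
    · simp [add_assoc]
    · simp [add_assoc]
    · simp [add_assoc]
  · rw [key.betti_eq]
    simp
  · rw [key.betti_eq]
    repeat rw [if_neg (by omega)]
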